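/- Let $\alpha \geq 0$, $\beta \geq 0$, $0 \leq \nu < 3$, $\nu \leq 2\beta$ and $\gamma \geq (3-\nu)/4$. Then there is a constant $C = C(\alpha,\beta,\nu,\gamma) > 0$ such that the following holds for every non-negative function $V$ on $(0,\infty)$ for which $V(x)^{\gamma + (1+\nu)/4}\, x^{\nu}$ is integrable on $(0,\infty)$. The quadratic form $$ u \mapsto \int_0^\infty \left( \left| \frac{d}{dx}\left( \frac{1}{x^\alpha} \frac{d}{dx}\left(\frac{u(x)}{x^\beta}\right)\right)\right|^2 x^{2(\alpha+\beta)} - V(x)|u(x)|^2 \right) dx , $$ defined on the complex-valued functions $u \in C_0^\infty(0,\infty)$, is lower semibounded and closable in $L^2(0,\infty)$. Let $H_0 - V$ be the self-adjoint operator in $L^2(0,\infty)$ associated with the closure of this form. The negative spectrum of $H_0 - V$ is discrete, that is, every negative point of the spectrum is an isolated point of the spectrum and an eigenvalue of finite multiplicity, and $$ \operatorname{tr}(H_0-V)_-^{\gamma} \leq C \int_0^\infty V(x)^{\gamma + \frac{1+\nu}{4}}\, x^{\nu}\, dx , $$ where $\operatorname{tr}(H_0-V)_-^{\gamma}$ denotes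 the sum of $|\lambda|^\gamma$ over the negative eigenvalues $\lambda$ of $H_0-V$, counted with multiplicity. -/

import Mathlib

open MeasureTheory Filter Topology Set
open scoped ENNReal Distributions

noncomputable section

section AbstractForms

/-! Quadratic forms `q` on a complex vector space `D` that is embedded in a Hilbert space `H`
by a linear map `j`. -/

variable {H : Type*} [NormedAddCommGroup H] [InnerProductSpace ℂ H]
variable {D : Type*} [AddCommGroup D] [Module ℂ D]

/-- `q` is lower semibounded: `q[u] ≥ m ‖u‖²` for some real `m` and all `u`. -/
def FormSemibounded (j : D →ₗ[ℂ] H) (q : D → ℝ) : Prop :=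
  ∃ m : ℝ, ∀ u : D, m * ‖j u‖ ^ 2 ≤ q u

/-- The sequence `s` in `D` is `q`-convergent to `u`:
`s n → u` in `H`, and `q[s n - s m] → 0` as `n, m → ∞`. -/
def FormConverges (j : D →ₗ[ℂ] H) (q : D → ℝ) (s : ℕ → D) (u : H) : Prop :=
  Tendsto (fun n => j (s n)) atTop (𝓝 u) ∧
    Tendsto (fun p : ℕ × ℕ => q (s p.1 - s p.2)) atTop (𝓝 0)

/-- `q` is closable: `q[s n] → 0` whenever `s` is `q`-convergent to `0`. -/
def FormClosable (j : D →ₗ[ℂ] H) (q : D → ℝ) : Prop :=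
  ∀ s : ℕ → D, FormConverges j q s 0 → Tendsto (fun n => q (s n)) atTop (𝓝 0)

/-- The sesquilinear form `b` with domain `Q` is the closure of `q`: its domain consists of the
limits of `q`-convergent sequences, and `b[u] = lim q[s n]` whenever `s` is `q`-convergent to `u`.
By polarization the values on the diagonal determine `b`. -/
structure IsFormClosure (j : D →ₗ[ℂ] H) (q : D → ℝ)
    (Q : Submodule ℂ H) (b : Q →ₗ⋆[ℂ] Q →ₗ[ℂ] ℂ) : Prop where
  mem_domain_iff : ∀ u : H, u ∈ Q ↔ ∃ s : ℕ → D, FormConverges j q s u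
  tendsto_diag : ∀ (u : Q) (s : ℕ → D), FormConverges j q s u →
    Tendsto (fun n => (q (s n) : ℂ)) atTop (𝓝 (b u u))

/-- `A` is the operator associated with the form `b` with domain `Q`: a vector `u` lies in the
domain of `A` with `A u = f` exactly when `u ∈ Q` and `b(u, v) = ⟨f, v⟩` for all `v ∈ Q`. -/
def IsFormOperator (Q : Submodule ℂ H) (b : Q →ₗ⋆[ℂ] Q →ₗ[ℂ] ℂ) (A : H →ₗ.[ℂ] H) : Prop :=
  ∀ u f : H, (u, f) ∈ A.graph ↔ ∃ hu : u ∈ Q, ∀ v : Q, b ⟨u, hu⟩ v = inner ℂ f (v : H)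

end AbstractForms

section UnboundedSpectrum

variable {H : Type*} [NormedAddCommGroup H] [InnerProductSpace ℂ H]

/-- The resolvent set of an unbounded operator: the `z` for which `A - z`, from the domain of `A`
to `H`, has a bounded everywhere defined two-sided inverse `R`. -/
def pmapResolventSet (A : H →ₗ.[ℂ] H) : Set ℂ :=
  {z | ∃ R : H →L[ℂ] H,
    (∀ f : H, ∃ h : R f ∈ A.domain, A ⟨R f, h⟩ - z • R f = f) ∧
    (∀ u : A.domain, R (A u - z • (u : H)) = u)}

/-- The spectrum of an unbounded operator. -/
def pmapSpectrum (A : H →ₗ.[ℂ] H) : Set ℂ := (pmapResolventSet A)ᶜ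

/-- The eigenspace `{u ∈ dom A : A u = z u}`. -/
def pmapEigenspace (A : H →ₗ.[ℂ] H) (z : ℂ) : Submodule ℂ H where
  carrier := {u | (u, z • u) ∈ A.graph}
  add_mem' {u v} hu hv := by
    have h := A.graph.add_mem hu hv
    rwa [Prod.mk_add_mk, ← smul_add] at h
  zero_mem' := by
    have h : ((0 : H), (0 : H)) ∈ A.graph := A.graph.zero_mem
    rwa [mem_ofPred_eq, smul_zero]
  smul_mem' c u hu := by
    have h := A.graph.smul_mem c hu
    rwa [Prod.smul_mk, smul_comm] at h

/-- The negative spectrum of `A` is discrete: every spectral point `l < 0` is an isolated point of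
the spectrum and an eigenvalue of finite multiplicity. -/
def DiscreteNegativeSpectrum (A : H →ₗ.[ℂ] H) : Prop :=
  ∀ l : ℝ, l < 0 → (l : ℂ) ∈ pmapSpectrum A →
    (∃ ε > 0, ∀ z ∈ pmapSpectrum A, dist z (l : ℂ) < ε → z = l) ∧
    pmapEigenspace A l ≠ ⊥ ∧ FiniteDimensional ℂ (pmapEigenspace A l)

/-- `tr A_-^γ`, the sum of `|l|^γ` over the negative eigenvalues `l` of `A`, each counted with its
multiplicity. (A number `l` that is not an eigenvalue has multiplicity zero.) -/
def traceNegPow (A : H →ₗ.[ℂ] H) (γ : ℝ) : ℝ≥0∞ :=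
  ∑' l : Iio (0 : ℝ),
    ((Cardinal.toENat (Module.rank ℂ (pmapEigenspace A ((l : ℝ) : ℂ))) : ℕ∞) : ℝ≥0∞) *
      ENNReal.ofReal (|(l : ℝ)| ^ γ)

end UnboundedSpectrum

section HalfLine

/-- The open half-line `(0, ∞)`. -/
def halfLine : TopologicalSpace.Opens ℝ := ⟨Ioi 0, isOpen_Ioi⟩

/-- The Hilbert space `L²(0, ∞)` of complex-valued functions. -/
abbrev L2HalfLine : Type := Lp ℂ 2 (volume.restrict (Ioi (0 : ℝ)))

theorem testFunction_memLp (u : 𝓓(halfLine, ℂ)) :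
    MemLp (u : ℝ → ℂ) 2 (volume.restrict (Ioi (0 : ℝ))) :=
  u.continuous.memLp_of_hasCompactSupport u.hasCompactSupport

/-- The embedding of `C₀^∞(0, ∞)` into `L²(0, ∞)`. -/
def testToL2 : 𝓓(halfLine, ℂ) →ₗ[ℂ] L2HalfLine where
  toFun u := (testFunction_memLp u).toLp u
  map_add' u v := MemLp.toLp_add (testFunction_memLp u) (testFunction_memLp v)
  map_smul' c u := MemLp.toLp_const_smul c (testFunction_memLp u)

/-- The differential expression `(x^{-α} (u / x^β)')'`. -/
def weightedSecondDeriv (α β : ℝ) (u : ℝ → ℂ) (x : ℝ) : ℂ :=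
  deriv (fun y : ℝ => (1 / y ^ α) • deriv (fun t : ℝ => (1 / t ^ β) • u t) y) x

/-- The quadratic form
`u ↦ ∫₀^∞ (|(x^{-α} (u / x^β)')'|² x^{2(α+β)} - V(x) |u(x)|²) dx` on `C₀^∞(0, ∞)`. -/
def halfLineForm (α β : ℝ) (V : ℝ → ℝ) (u : 𝓓(halfLine, ℂ)) : ℝ :=
  ∫ x in Ioi (0 : ℝ),
    (‖weightedSecondDeriv α β u x‖ ^ 2 * x ^ (2 * (α + β)) - V x * ‖u x‖ ^ 2)

end HalfLine

end

noncomputable section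

/-! ### Spectrum of a bounded self-adjoint operator above a level of finite index -/

section BoundedSelfAdjoint

open Module

variable {H : Type*} [NormedAddCommGroup H] [InnerProductSpace ℂ H]

/-! Write `L u = x^{α+β} (x^{-α} (x^{-β} u)')'`, `p = γ + (1+ν)/4` and `μ = ν/p`. The condition on
`γ` says `p ≥ 1`, so `μ ≤ ν` and hence `μ < 3`, `μ ≤ 2β`. The proof cuts the half-line into
intervals adapted to `V` and spends two linear conditions on each interval that is too short.

Analysis on one interval of length `l`. The kernel of `L` is two-dimensional, and subtracting from
`u` the kernel element with the same Cauchy data at the right end leaves a Taylor remainder whose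
square times `x^{-μ}` is at most a constant times `l^{3-μ} ∫ |L u|²` (`norm_sub_kernelPart_sq_le`).
The kernel element itself costs an extra `l^{-4} ∫ |u|²` (`norm_sq_mul_rpow_le`). If `l^{4γ} ∫ V^p
x^ν` is at most a suitable constant `κ`, then `l^{3-μ} ∫ V x^μ` is small, so `∫ V|u|² ≤ 1/2 (∫ |L
u|² + l^{-4} ∫ |u|²)`, and the last term disappears when the two Cauchy data vanish.

Counting. Take a partition whose intervals all satisfy the smallness condition (`exists_partition`).
Given `E > 0`, impose vanishing Cauchy data only where `l_k^{-4} > E`; on that subspace the form is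
at least `-E ‖u‖²`. Hence at most `2 #{k : l_k^{-4} > E}` eigenvalues lie below `-E`, and
integrating over `E` gives a trace at most `2 ∑ l_k^{-4γ}`. Up to an arbitrary `δ > 0`, the
partition makes `l_k^{-4γ}` equal to the mass of the interval divided by `κ`, so the sum telescopes.

Operator theory. The partition also shows that `V` has relative form bound `1/2`, so the form closes
in the graph space of `(1, L, √V)` and a Lax-Milgram argument yields a bounded injective resolvent
`R`; the operator is `R⁻¹ - m`. Spectral statements are proved for `R`, where an index bound on its
quadratic form replaces the spectral theorem (`UpperIndexLE.exists_eigenvector`,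
`FormModel.upperIndexLE`). -/

theorem inner_self_eq_ofReal (v : H) : inner ℂ v v = ((‖v‖ ^ 2 : ℝ) : ℂ) := by
  rw [inner_self_eq_norm_sq_to_K]; simp

/-- Every finite-dimensional subspace on which the quadratic form of `T` exceeds `c ‖u‖²` has
dimension at most `n`. -/
def UpperIndexLE (T : H →L[ℂ] H) (c : ℝ) (n : ℕ) : Prop :=
  ∀ W : Submodule ℂ H, FiniteDimensional ℂ W →
    (∀ u ∈ W, u ≠ 0 → c * ‖u‖ ^ 2 < (inner ℂ (T u) u).re) → finrank ℂ W ≤ n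

theorem UpperIndexLE.finiteDimensional {T : H →L[ℂ] H} {c : ℝ} {n : ℕ} (h : UpperIndexLE T c n)
    (W : Submodule ℂ H) (hW : ∀ u ∈ W, u ≠ 0 → c * ‖u‖ ^ 2 < (inner ℂ (T u) u).re) :
    FiniteDimensional ℂ W := by
  rw [FiniteDimensional, ← Module.rank_lt_aleph0_iff]
  by_contra! hinf
  have hn : ((n + 1 : ℕ) : Cardinal) ≤ Module.rank ℂ W := (Cardinal.natCast_lt_aleph0).le.trans hinf
  obtain ⟨f, hf⟩ := Module.le_rank_iff_exists_linearMap.1 hn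
  have hinj : Function.Injective (W.subtype ∘ₗ f) := W.injective_subtype.comp hf
  have hle := h (LinearMap.range (W.subtype ∘ₗ f)) inferInstance (by
    rintro u ⟨x, rfl⟩ hu
    exact hW _ (f x).2 hu)
  rw [LinearMap.finrank_range_of_inj hinj] at hle
  simp at hle

variable [CompleteSpace H]

/-- Otherwise `X = T - l` is bounded below. Being self-adjoint, it satisfies `⟨X² x, x⟩ = ‖X x‖²`,
so `X²` is coercive and invertible, and therefore so is its factor `X`. -/
theorem IsSelfAdjoint.exists_approx_eigenvector {T : H →L[ℂ] H} (hT : IsSelfAdjoint T) {l : ℝ}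
    (hl : (l : ℂ) ∈ spectrum ℂ T) {ε : ℝ} (hε : 0 < ε) :
    ∃ u : H, ‖u‖ = 1 ∧ ‖T u - (l : ℂ) • u‖ < ε := by
  by_contra! hcon
  have hbelow : ∀ u : H, ε * ‖u‖ ≤ ‖T u - (l : ℂ) • u‖ := by
    intro u
    rcases eq_or_ne u 0 with rfl | hu
    · simp
    have hn : (0 : ℝ) < ‖u‖ := norm_pos_iff.2 hu
    have h1 := hcon ((‖u‖⁻¹ : ℂ) • u) (by
      rw [norm_smul, norm_inv, Complex.norm_real, norm_norm, inv_mul_cancel₀ hn.ne'])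
    rw [map_smul, smul_comm, ← smul_sub, norm_smul, norm_inv, Complex.norm_real, norm_norm] at h1
    rwa [inv_mul_eq_div, le_div_iff₀ hn] at h1
  set X : H →L[ℂ] H := T - algebraMap ℂ (H →L[ℂ] H) l with hX
  have hXapp : ∀ u, X u = T u - (l : ℂ) • u := fun u => by
    simp [hX, Algebra.algebraMap_eq_smul_one]
  have hXsa : IsSelfAdjoint X := by
    refine hT.sub ?_
    rw [IsSelfAdjoint, ← algebraMap_star_comm]
    simp
  have hXX : IsUnit (X * X) := by
    refine ContinuousLinearMap.isUnit_of_forall_le_norm_inner_map (X * X)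
      (c := (ε ^ 2).toNNReal) (Real.toNNReal_pos.2 (by positivity)) ?_
    intro x
    have hs := (ContinuousLinearMap.isSelfAdjoint_iff_isSymmetric.1 hXsa) (X x) x
    simp only [ContinuousLinearMap.coe_coe] at hs
    rw [mul_apply_eq_comp, hs, inner_self_eq_ofReal, Complex.norm_real,
      Real.norm_of_nonneg (by positivity)]
    have := hbelow x
    rw [← hXapp] at this
    have h0 : (0 : ℝ) ≤ ε * ‖x‖ := by positivity
    have h2 := pow_le_pow_left₀ h0 this 2
    rw [Real.coe_toNNReal _ (by positivity)]
    linarith [mul_pow ε ‖x‖ 2, h2, mul_comm (‖x‖ ^ 2) (ε ^ 2)]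
  have hXu : IsUnit X := by
    have hc : Commute X X := Commute.refl X
    exact (hc.isUnit_mul_iff.1 hXX).1
  apply hl
  rw [spectrum.mem_resolventSet_iff, ← neg_sub]
  exact hXu.neg

/-- Let `W` be a subspace of maximal dimension on which the form of `T - c` is positive. By
maximality the form is nonpositive on the orthogonal complement of `(T - c) W`, so `T - l` is
bounded below there. Only the finite-dimensional space `(T - c) W` remains, and there approximate
eigenvectors have convergent subsequences. -/
theorem UpperIndexLE.exists_eigenvector {T : H →L[ℂ] H} (hT : IsSelfAdjoint T) {c : ℝ} {n : ℕ}
    (h : UpperIndexLE T c n) {l : ℝ} (hcl : c < l) (hl : (l : ℂ) ∈ spectrum ℂ T) :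
    ∃ u : H, u ≠ 0 ∧ T u = (l : ℂ) • u := by
  have hsym := ContinuousLinearMap.isSelfAdjoint_iff_isSymmetric.1 hT
  have hsym' : ∀ x y : H, inner ℂ (T x) y = inner ℂ x (T y) := hsym
  -- a positive subspace of maximal dimension
  obtain ⟨W, hWfd, hWpos, hWmax⟩ : ∃ W : Submodule ℂ H, FiniteDimensional ℂ W ∧
      (∀ u ∈ W, u ≠ 0 → c * ‖u‖ ^ 2 < (inner ℂ (T u) u).re) ∧
      ∀ W' : Submodule ℂ H, FiniteDimensional ℂ W' →
        (∀ u ∈ W', u ≠ 0 → c * ‖u‖ ^ 2 < (inner ℂ (T u) u).re) →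
        finrank ℂ W' ≤ finrank ℂ W := by
    let S : Set ℕ := {k | ∃ W : Submodule ℂ H, FiniteDimensional ℂ W ∧
      (∀ u ∈ W, u ≠ 0 → c * ‖u‖ ^ 2 < (inner ℂ (T u) u).re) ∧ finrank ℂ W = k}
    have hbdd : BddAbove S := ⟨n, by rintro k ⟨W, h1, h2, rfl⟩; exact h W h1 h2⟩
    have hne : S.Nonempty := ⟨_, ⊥, inferInstance, by
      intro u hu hu0; exact absurd ((Submodule.mem_bot ℂ).1 hu) hu0, rfl⟩
    obtain ⟨W, h1, h2, h3⟩ := Nat.sSup_mem hne hbdd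
    exact ⟨W, h1, h2, fun W' h1' h2' => h3 ▸ le_csSup hbdd ⟨W', h1', h2', rfl⟩⟩
  let X : H →ₗ[ℂ] H := (T : H →ₗ[ℂ] H) - (c : ℂ) • LinearMap.id
  let Y : Submodule ℂ H := W.map X
  -- A vector `z` violating this could be added to `W`: it is orthogonal to `W` with respect to the
  -- form of `T - c`, so the cross terms in the form on `W + ℂ z` cancel.
  have hUneg : ∀ z ∈ Yᗮ, (inner ℂ (T z) z).re ≤ c * ‖z‖ ^ 2 := by
    intro z hz
    by_contra! hpos
    have horth : ∀ w ∈ W, inner ℂ (T w) z = (c : ℂ) * inner ℂ w z := by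
      intro w hw
      have h1 : inner ℂ (X w) z = 0 := hz (X w) (Submodule.mem_map_of_mem hw)
      simp only [X, LinearMap.sub_apply, LinearMap.smul_apply, LinearMap.id_apply,
        ContinuousLinearMap.coe_coe, inner_sub_left, inner_smul_left, Complex.conj_ofReal] at h1
      exact sub_eq_zero.1 h1
    have hzW : z ∉ W := by
      intro hzW
      have h1 := congrArg Complex.re (horth z hzW)
      rw [inner_self_eq_ofReal, ← Complex.ofReal_mul, Complex.ofReal_re] at h1
      linarith
    have hlt : W < W ⊔ Submodule.span ℂ {z} := by
      refine lt_of_le_of_ne le_sup_left fun heq => hzW ?_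
      rw [heq]
      exact Submodule.mem_sup_right (Submodule.mem_span_singleton_self z)
    have hle := hWmax (W ⊔ Submodule.span ℂ {z}) inferInstance (by
      intro u hu hu0
      obtain ⟨w, hw, y, hy, rfl⟩ := Submodule.mem_sup.1 hu
      obtain ⟨a, rfl⟩ := Submodule.mem_span_singleton.1 hy
      have e1 := horth w hw
      have e2 : inner ℂ (T z) w = (c : ℂ) * inner ℂ z w := by
        rw [hsym', ← inner_conj_symm, e1, map_mul, inner_conj_symm, Complex.conj_ofReal]
      have key : (inner ℂ (T (w + a • z)) (w + a • z)).re - c * ‖w + a • z‖ ^ 2 =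
          ((inner ℂ (T w) w).re - c * ‖w‖ ^ 2) +
            ‖a‖ ^ 2 * ((inner ℂ (T z) z).re - c * ‖z‖ ^ 2) := by
        have n1 : ∀ v : H, ‖v‖ ^ 2 = (inner ℂ v v).re := fun v => by
          rw [inner_self_eq_ofReal, Complex.ofReal_re]
        have n2 : ∀ v : H, ((inner ℂ (T v) v).re - c * ‖v‖ ^ 2) =
            (inner ℂ (T v) v - (c : ℂ) * inner ℂ v v).re := fun v => by
          rw [n1]; simp
        rw [n2, n2, n2, ← Complex.re_ofReal_mul, ← Complex.add_re]
        congr 1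
        simp only [map_add, map_smul, inner_add_left, inner_add_right, inner_smul_left,
          inner_smul_right, e1, e2]
        have ha : (starRingEnd ℂ) a * a = ((‖a‖ ^ 2 : ℝ) : ℂ) := by
          rw [Complex.conj_mul']; simp
        rw [← ha]
        ring
      rcases eq_or_ne w 0 with rfl | hw0
      · have ha0 : a ≠ 0 := by rintro rfl; simp at hu0
        have : 0 < ‖a‖ ^ 2 * ((inner ℂ (T z) z).re - c * ‖z‖ ^ 2) :=
          mul_pos (by positivity) (by linarith)
        simp only [map_zero, inner_zero_left, norm_zero, Complex.zero_re] at key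
        linarith
      · have h1 := hWpos w hw hw0
        have : 0 ≤ ‖a‖ ^ 2 * ((inner ℂ (T z) z).re - c * ‖z‖ ^ 2) :=
          mul_nonneg (by positivity) (by linarith)
        linarith)
    exact absurd (Submodule.finrank_lt_finrank_of_lt hlt) (not_lt.2 hle)
  have hUbelow : ∀ z ∈ Yᗮ, (l - c) * ‖z‖ ≤ ‖T z - (l : ℂ) • z‖ := by
    intro z hz
    have h1 := hUneg z hz
    have h2 : (inner ℂ (T z - (l : ℂ) • z) z).re = (inner ℂ (T z) z).re - l * ‖z‖ ^ 2 := by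
      rw [inner_sub_left, inner_smul_left, inner_self_eq_ofReal, Complex.conj_ofReal,
        ← Complex.ofReal_mul, Complex.sub_re, Complex.ofReal_re]
    have h3 : -(inner ℂ (T z - (l : ℂ) • z) z).re ≤ ‖T z - (l : ℂ) • z‖ * ‖z‖ :=
      (neg_le_abs _).trans ((Complex.abs_re_le_norm _).trans (norm_inner_le_norm _ _))
    rcases eq_or_ne z 0 with rfl | hz0
    · simp
    have hn : (0 : ℝ) < ‖z‖ := norm_pos_iff.2 hz0
    refine le_of_mul_le_mul_right ?_ hn
    nlinarith
  choose u hu1 hu2 using fun k : ℕ =>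
    hT.exists_approx_eigenvector hl (Nat.one_div_pos_of_nat (α := ℝ) (n := k))
  have : ProperSpace Y := FiniteDimensional.proper ℂ Y
  let y : ℕ → Y := fun k => Y.orthogonalProjectionOnto (u k)
  have hy : ∀ k, y k ∈ Metric.closedBall (0 : Y) 1 := by
    intro k
    rw [mem_closedBall_zero_iff]
    calc ‖y k‖ ≤ ‖u k‖ := Y.norm_orthogonalProjectionOnto_apply_le (u k)
      _ = 1 := hu1 k
  obtain ⟨y0, -, φ, hφ, hlim⟩ := tendsto_subseq_of_bounded Metric.isBounded_closedBall hy
  let z : ℕ → H := fun k => u (φ k) - (y (φ k) : H)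
  have hzU : ∀ k, z k ∈ Yᗮ := fun k => Submodule.sub_starProjection_mem_orthogonal (u (φ k))
  let X' : H →L[ℂ] H := T - (l : ℂ) • ContinuousLinearMap.id ℂ H
  have hX' : ∀ v, X' v = T v - (l : ℂ) • v := fun v => rfl
  have hylim : Tendsto (fun k => ((y (φ k) : Y) : H)) atTop (𝓝 (y0 : H)) :=
    (continuous_subtype_val.tendsto y0).comp hlim
  have hXu : Tendsto (fun k => X' (u (φ k))) atTop (𝓝 0) := by
    refine squeeze_zero_norm (fun k => (hu2 (φ k)).le) ?_
    exact (tendsto_one_div_add_atTop_nhds_zero_nat (𝕜 := ℝ)).comp hφ.tendsto_atTop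
  have hXz : Tendsto (fun k => X' (z k)) atTop (𝓝 (0 - X' y0)) := by
    have := hXu.sub ((X'.continuous.tendsto _).comp hylim)
    refine this.congr fun k => ?_
    simp only [z, map_sub, Function.comp_apply]
  -- `T - l` is bounded below on the closed complement, so convergence of `(T - l) z` forces
  -- convergence of `z`.
  have hzc : CauchySeq z := by
    have hc := hXz.cauchySeq
    rw [Metric.cauchySeq_iff] at hc ⊢
    intro ε hε
    obtain ⟨N, hN⟩ := hc ((l - c) * ε) (mul_pos (sub_pos.2 hcl) hε)
    refine ⟨N, fun i hi j hj => ?_⟩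
    have h1 := hN i hi j hj
    rw [dist_eq_norm, ← map_sub, hX'] at h1
    have h2 := hUbelow (z i - z j) (Submodule.sub_mem _ (hzU i) (hzU j))
    rw [dist_eq_norm]
    exact lt_of_mul_lt_mul_left (h2.trans_lt h1) (sub_pos.2 hcl).le
  obtain ⟨z0, hz0⟩ := cauchySeq_tendsto_of_complete hzc
  have hulim : Tendsto (fun k => u (φ k)) atTop (𝓝 (z0 + y0)) := by
    refine (hz0.add hylim).congr fun k => ?_
    simp [z]
  refine ⟨z0 + y0, ?_, ?_⟩
  · have h1 := hulim.norm
    simp only [hu1] at h1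
    have h2 := tendsto_nhds_unique h1 tendsto_const_nhds
    intro h3
    rw [h3, norm_zero] at h2
    exact zero_ne_one h2
  · have := tendsto_nhds_unique ((X'.continuous.tendsto _).comp hulim) hXu
    rw [hX'] at this
    exact sub_eq_zero.1 this

/-- Eigenspaces to distinct eigenvalues are orthogonal, so on their sum the form of `T` is diagonal
with entries above `c`; the index bound applies to the whole sum. -/
theorem UpperIndexLE.sum_finrank_eigenspace_le {T : H →L[ℂ] H} (hT : IsSelfAdjoint T) {c : ℝ}
    {n : ℕ} (h : UpperIndexLE T c n) {ι : Type*} (F : Finset ι) (l : ι → ℝ)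
    (hinj : Set.InjOn l F) (hF : ∀ i ∈ F, c < l i) :
    ∑ i ∈ F, finrank ℂ (End.eigenspace (T : H →ₗ[ℂ] H) (l i : ℂ)) ≤ n := by
  have hsym := ContinuousLinearMap.isSelfAdjoint_iff_isSymmetric.1 hT
  have heig : ∀ (m : ℝ) (v : End.eigenspace (T : H →ₗ[ℂ] H) (m : ℂ)), T v = (m : ℂ) • (v : H) :=
    fun m v => End.mem_eigenspace_iff.1 v.2
  have hfam := hsym.orthogonalFamily_eigenspaces.comp (γ := F) (f := fun i => ((l i : ℝ) : ℂ))
    (fun i j hij => Subtype.ext (hinj i.2 j.2 (Complex.ofReal_injective hij)))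
  have hfd : ∀ i : F, FiniteDimensional ℂ (End.eigenspace (T : H →ₗ[ℂ] H) (l i : ℂ)) := by
    intro i
    refine h.finiteDimensional _ fun u hu hu0 => ?_
    rw [heig (l i) ⟨u, hu⟩, inner_smul_left, inner_self_eq_ofReal, Complex.conj_ofReal,
      ← Complex.ofReal_mul, Complex.ofReal_re]
    exact mul_lt_mul_of_pos_right (hF i i.2) (by positivity)
  let Ψ : (Π i : F, End.eigenspace (T : H →ₗ[ℂ] H) (l i : ℂ)) →ₗ[ℂ] H :=
    ∑ i : F, (Submodule.subtype _) ∘ₗ LinearMap.proj i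
  have hΨ : ∀ x, Ψ x = ∑ i : F, ((x i : End.eigenspace (T : H →ₗ[ℂ] H) (l i : ℂ)) : H) :=
    fun x => by simp [Ψ]
  have hnorm : ∀ x, ‖Ψ x‖ ^ 2 = ∑ i : F, ‖x i‖ ^ 2 := fun x => by
    rw [hΨ]; exact hfam.norm_sum x Finset.univ
  have hform : ∀ x, (inner ℂ (T (Ψ x)) (Ψ x)).re = ∑ i : F, l i * ‖x i‖ ^ 2 := fun x => by
    have e1 : T (Ψ x) = Ψ (fun i => (l i : ℂ) • x i) := by
      rw [hΨ, hΨ, map_sum]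
      exact Finset.sum_congr rfl fun i _ => heig _ _
    rw [e1, hΨ, hΨ]
    have e2 := hfam.inner_sum (fun i => (l i : ℂ) • x i) x Finset.univ
    simp only [Submodule.coe_subtypeₗᵢ, Submodule.coe_subtype] at e2
    rw [e2, Complex.re_sum]
    refine Finset.sum_congr rfl fun i _ => ?_
    rw [inner_smul_left, inner_self_eq_ofReal, Complex.conj_ofReal,
      ← Complex.ofReal_mul, Complex.ofReal_re]
  have hker : ∀ x, Ψ x = 0 → x = 0 := by
    intro x hx
    have h1 := hnorm x
    rw [hx, norm_zero, zero_pow two_ne_zero] at h1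
    have h2 := (Finset.sum_eq_zero_iff_of_nonneg (fun i _ => by positivity)).1 h1.symm
    funext i
    simpa using h2 i (Finset.mem_univ i)
  have hΨinj : Function.Injective Ψ := (injective_iff_map_eq_zero Ψ).2 hker
  have hle := h (LinearMap.range Ψ) inferInstance (by
    rintro _ ⟨x, rfl⟩ hx0
    rw [hform, hnorm, Finset.mul_sum]
    have hx : x ≠ 0 := by rintro rfl; simp at hx0
    obtain ⟨i, hi⟩ := Function.ne_iff.1 hx
    refine Finset.sum_lt_sum (fun j _ => ?_) ⟨i, Finset.mem_univ i, ?_⟩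
    · exact mul_le_mul_of_nonneg_right (hF j j.2).le (by positivity)
    · exact mul_lt_mul_of_pos_right (hF i i.2) (pow_pos (norm_pos_iff.2 hi) 2))
  rw [LinearMap.finrank_range_of_inj hΨinj, Module.finrank_pi_fintype] at hle
  rw [← Finset.sum_coe_sort]
  exact hle

end BoundedSelfAdjoint

/-! ### The unbounded operator with a given bounded resolvent -/

section ResolventOperator

open Module

variable {H : Type*} [NormedAddCommGroup H] [InnerProductSpace ℂ H]

/-- The unbounded operator `R⁻¹ - m`. -/
def invSubConst (R : H →L[ℂ] H) (m : ℝ) : H →ₗ.[ℂ] H :=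
  (LinearMap.range ((R : H →ₗ[ℂ] H).prod
    (LinearMap.id - (m : ℂ) • (R : H →ₗ[ℂ] H)))).toLinearPMap

variable {R : H →L[ℂ] H} {m : ℝ}

theorem mem_invSubConst_graph (hinj : Function.Injective R) {u f : H} :
    (u, f) ∈ (invSubConst R m).graph ↔ R (f + (m : ℂ) • u) = u := by
  rw [invSubConst, Submodule.toLinearPMap_graph_eq]
  · constructor
    · rintro ⟨g, hg⟩
      simp only [LinearMap.prod_apply, Function.prod_apply, LinearMap.sub_apply,
        LinearMap.id_apply, LinearMap.smul_apply, ContinuousLinearMap.coe_coe,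
        Prod.mk.injEq] at hg
      obtain ⟨rfl, rfl⟩ := hg
      simp
    · intro h
      refine ⟨f + (m : ℂ) • u, ?_⟩
      simp only [LinearMap.prod_apply, Function.prod_apply, LinearMap.sub_apply,
        LinearMap.id_apply, LinearMap.smul_apply, ContinuousLinearMap.coe_coe, h]
      simp
  · rintro _ ⟨g, rfl⟩ hg
    simp only [LinearMap.prod_apply, Function.prod_apply, ContinuousLinearMap.coe_coe] at hg
    have : g = 0 := hinj (by rw [hg, map_zero])
    simp [this]

theorem apply_mem_invSubConst_graph (hinj : Function.Injective R) (g : H) :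
    (R g, g - (m : ℂ) • R g) ∈ (invSubConst R m).graph := by
  rw [mem_invSubConst_graph hinj, sub_add_cancel]

theorem pmapEigenspace_invSubConst (hinj : Function.Injective R) {l : ℝ} (hl : l + m ≠ 0) :
    pmapEigenspace (invSubConst R m) (l : ℂ) =
      End.eigenspace (R : H →ₗ[ℂ] H) (((l + m)⁻¹ : ℝ) : ℂ) := by
  ext u
  have hl' : ((l : ℂ) + m) ≠ 0 := by exact_mod_cast hl
  rw [End.mem_eigenspace_iff]
  change (u, (l : ℂ) • u) ∈ (invSubConst R m).graph ↔ _
  rw [mem_invSubConst_graph hinj, ← add_smul, map_smul, ContinuousLinearMap.coe_coe]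
  push_cast
  exact (eq_inv_smul_iff₀ hl').symm

theorem neg_mem_pmapResolventSet (hinj : Function.Injective R) :
    ((-m : ℝ) : ℂ) ∈ pmapResolventSet (invSubConst R m) := by
  refine ⟨R, fun f => ?_, fun u => ?_⟩
  · obtain ⟨u, hu1, hu2⟩ := (LinearPMap.mem_graph_iff _).1 (apply_mem_invSubConst_graph (m := m) hinj f)
    simp only at hu1 hu2
    refine ⟨hu1 ▸ u.2, ?_⟩
    have : (⟨R f, hu1 ▸ u.2⟩ : (invSubConst R m).domain) = u := Subtype.ext hu1.symm
    rw [this, hu2]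
    simp
  · have h := (mem_invSubConst_graph hinj).1 ((invSubConst R m).mem_graph u)
    rw [Complex.ofReal_neg, neg_smul, sub_neg_eq_add, h]

/-- With `X = (z + m)⁻¹ - R` one has `(A - z) R g = (z + m) X g`, where `A = R⁻¹ - m`. Inverting `X`
therefore gives the resolvent `(z + m)⁻¹ R X⁻¹`. -/
theorem mem_pmapResolventSet_invSubConst (hinj : Function.Injective R) {z : ℂ}
    (hz : z + m ≠ 0) (hR : (z + m)⁻¹ ∉ spectrum ℂ R) :
    z ∈ pmapResolventSet (invSubConst R m) := by
  rw [spectrum.notMem_iff] at hR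
  obtain ⟨X, hX⟩ := hR
  have hXapp : ∀ v, (X : H →L[ℂ] H) v = (z + m)⁻¹ • v - R v := fun v => by
    rw [hX]; simp [Algebra.algebraMap_eq_smul_one]
  let Y : H →L[ℂ] H := ((X⁻¹ : (H →L[ℂ] H)ˣ) : H →L[ℂ] H)
  have hXY : ∀ v, (X : H →L[ℂ] H) (Y v) = v := fun v => by
    have := congrArg (fun T : H →L[ℂ] H => T v) X.mul_inv
    exact this
  have hYX : ∀ v, Y ((X : H →L[ℂ] H) v) = v := fun v => by
    have := congrArg (fun T : H →L[ℂ] H => T v) X.inv_mul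
    exact this
  have hcoef : ∀ v, v - (m : ℂ) • R v - z • R v = (z + m) • (X : H →L[ℂ] H) v := fun v => by
    rw [hXapp, smul_sub, smul_inv_smul₀ hz, add_smul]
    abel
  refine ⟨(z + m)⁻¹ • (R.comp Y), fun f => ?_, fun u => ?_⟩
  · have hmem := apply_mem_invSubConst_graph (m := m) hinj ((z + m)⁻¹ • Y f)
    obtain ⟨u, hu1, hu2⟩ := (LinearPMap.mem_graph_iff _).1 hmem
    simp only at hu1 hu2
    have hRf : ((z + m)⁻¹ • (R.comp Y)) f = R ((z + m)⁻¹ • Y f) := by simp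
    have hd : ((z + m)⁻¹ • (R.comp Y)) f ∈ (invSubConst R m).domain := by
      rw [hRf, ← hu1]; exact u.2
    refine ⟨hd, ?_⟩
    have : (⟨_, hd⟩ : (invSubConst R m).domain) = u := Subtype.ext (hRf.trans hu1.symm)
    rw [this, hu2, hRf, hcoef, map_smul, hXY, smul_inv_smul₀ hz]
  · have h := (mem_invSubConst_graph hinj).1 ((invSubConst R m).mem_graph u)
    set g := invSubConst R m u + (m : ℂ) • (u : H) with hg
    have e1 : invSubConst R m u - z • (u : H) = (z + m) • (X : H →L[ℂ] H) g := by
      rw [← hcoef, h, hg]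
      simp
    rw [e1]
    simp only [smul_apply, ContinuousLinearMap.comp_apply, map_smul, hYX, h]
    rw [smul_inv_smul₀ hz]

theorem mem_pmapSpectrum_of_eigenspace_ne_bot {A : H →ₗ.[ℂ] H} {z : ℂ}
    (h : pmapEigenspace A z ≠ ⊥) : z ∈ pmapSpectrum A := by
  rintro ⟨T, -, hT⟩
  obtain ⟨u, hu, hu0⟩ := Submodule.exists_mem_ne_zero_of_ne_bot h
  obtain ⟨v, hv1, hv2⟩ := (LinearPMap.mem_graph_iff _).1 (show (u, z • u) ∈ A.graph from hu)
  simp only at hv1 hv2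
  have := hT v
  rw [hv2, hv1, sub_self, map_zero] at this
  exact hu0 this.symm

variable [CompleteSpace H]

/-- The graph of the operator is parametrised by `f ↦ (R f, f - m R f)`. By symmetry of `R`, the
condition defining the adjoint graph at `(y, w)` becomes `⟨f, y - R (w + m y)⟩ = 0` for all `f`,
which is membership of `(y, w)` in the graph itself. -/
theorem isSelfAdjoint_invSubConst (hR : IsSelfAdjoint R) (hinj : Function.Injective R) :
    IsSelfAdjoint (invSubConst R m) := by
  have hsym : ∀ x y : H, inner ℂ (R x) y = inner ℂ x (R y) :=
    ContinuousLinearMap.isSelfAdjoint_iff_isSymmetric.1 hR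
  have hdense : Dense ((invSubConst R m).domain : Set H) := by
    rw [Submodule.dense_iff_topologicalClosure_eq_top, Submodule.topologicalClosure_eq_top_iff,
      Submodule.eq_bot_iff]
    intro y hy
    refine hinj (ext_inner_left ℂ fun f => ?_)
    rw [map_zero, inner_zero_right, ← hsym]
    exact hy _ (LinearPMap.mem_domain_of_mem_graph (apply_mem_invSubConst_graph hinj f))
  rw [LinearPMap.isSelfAdjoint_def]
  refine LinearPMap.eq_of_eq_graph ?_
  rw [LinearPMap.adjoint_graph_eq_graph_adjoint hdense]
  ext ⟨y, w⟩
  rw [Submodule.mem_adjoint_iff, mem_invSubConst_graph hinj]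
  have hcalc : ∀ f : H, inner ℂ (f - (m : ℂ) • R f) y - inner ℂ (R f) w =
      inner ℂ f y - inner ℂ f (R (w + (m : ℂ) • y)) := fun f => by
    rw [← hsym, inner_add_right, inner_sub_left, inner_smul_left, inner_smul_right,
      Complex.conj_ofReal]
    ring
  constructor
  · intro h
    refine ext_inner_left ℂ fun f => ?_
    have := h _ _ (apply_mem_invSubConst_graph (m := m) hinj f)
    rw [hcalc] at this
    exact (sub_eq_zero.1 this).symm
  · intro h a b hab
    have hab' := (mem_invSubConst_graph hinj).1 hab
    have := hcalc (b + (m : ℂ) • a)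
    rw [hab', add_sub_cancel_right, h, sub_self] at this
    exact this

theorem spectrum_re_nonneg (hR : IsSelfAdjoint R) (hpos : ∀ f, 0 ≤ (inner ℂ (R f) f).re) {l : ℝ}
    (hl : (l : ℂ) ∈ spectrum ℂ R) : 0 ≤ l := by
  by_contra! hneg
  obtain ⟨u, hu1, hu2⟩ := hR.exists_approx_eigenvector hl (neg_pos.2 hneg)
  have h1 := hpos u
  have h2 : (inner ℂ (R u - (l : ℂ) • u) u).re = (inner ℂ (R u) u).re - l := by
    rw [inner_sub_left, inner_smul_left, inner_self_eq_ofReal, Complex.conj_ofReal,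
      ← Complex.ofReal_mul, Complex.sub_re, Complex.ofReal_re, hu1]
    ring
  have h3 := (Complex.re_le_norm _).trans (norm_inner_le_norm (𝕜 := ℂ) (R u - (l : ℂ) • u) u)
  rw [hu1, mul_one] at h3
  linarith

/-- A spectral point of `R⁻¹ - m` is real and exceeds `-m`, and it comes from a spectral point of
`R`. -/
theorem pmapSpectrum_invSubConst (hR : IsSelfAdjoint R) (hinj : Function.Injective R)
    (hpos : ∀ f, 0 ≤ (inner ℂ (R f) f).re) {z : ℂ} (hz : z ∈ pmapSpectrum (invSubConst R m)) :
    z = (z.re : ℂ) ∧ 0 < z.re + m ∧ (((z.re + m)⁻¹ : ℝ) : ℂ) ∈ spectrum ℂ R := by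
  have hzm : z + m ≠ 0 := by
    intro h
    apply hz
    have : z = ((-m : ℝ) : ℂ) := by push_cast; exact eq_neg_of_add_eq_zero_left h
    rw [this]
    exact neg_mem_pmapResolventSet hinj
  have hs : (z + m)⁻¹ ∈ spectrum ℂ R := by
    by_contra hs
    exact hz (mem_pmapResolventSet_invSubConst hinj hzm hs)
  have hre := hR.mem_spectrum_eq_re hs
  have hz1 : z = (((z + m)⁻¹.re⁻¹ - m : ℝ) : ℂ) := by
    push_cast
    rw [← hre]
    simp
  have hz2 : z = (z.re : ℂ) := by
    conv_rhs => rw [hz1]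
    rw [Complex.ofReal_re]
    exact hz1
  have hs2 : (((z.re + m)⁻¹ : ℝ) : ℂ) ∈ spectrum ℂ R := by
    push_cast
    rwa [← hz2]
  refine ⟨hz2, ?_, hs2⟩
  have h0 : 0 ≤ z.re + m := inv_nonneg.1 (spectrum_re_nonneg hR hpos hs2)
  refine lt_of_le_of_ne h0 fun h => hzm ?_
  rw [hz2]
  exact_mod_cast h.symm

theorem discreteNegativeSpectrum_invSubConst (hR : IsSelfAdjoint R) (hinj : Function.Injective R)
    (hpos : ∀ f, 0 ≤ (inner ℂ (R f) f).re)
    (hidx : ∀ E : ℝ, 0 < E → E < m → ∃ n, UpperIndexLE R (m - E)⁻¹ n) :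
    DiscreteNegativeSpectrum (invSubConst R m) := by
  intro l hl hls
  obtain ⟨-, hlm, hlR⟩ := pmapSpectrum_invSubConst hR hinj hpos hls
  rw [Complex.ofReal_re] at hlm hlR
  -- The level `l / 2` leaves room on both sides of `l`: all spectral points below `l / 2` are
  -- eigenvalues, and only finitely many exist, because each uses at least one dimension of the
  -- index.
  obtain ⟨n, hn⟩ := hidx (-l / 2) (by linarith) (by linarith)
  have hinv : ∀ k : ℝ, 0 < k + m → k < l / 2 → (m - -l / 2)⁻¹ < (k + m)⁻¹ := fun k hk hkl =>
    inv_strictAnti₀ hk (by linarith)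
  have hfin : ∀ k : ℝ, 0 < k + m → k < l / 2 →
      FiniteDimensional ℂ (End.eigenspace (R : H →ₗ[ℂ] H) (((k + m)⁻¹ : ℝ) : ℂ)) := by
    intro k hk hkl
    refine hn.finiteDimensional _ fun u hu hu0 => ?_
    have e : R u = (((k + m)⁻¹ : ℝ) : ℂ) • u := End.mem_eigenspace_iff.1 hu
    rw [e, inner_smul_left, inner_self_eq_ofReal, Complex.conj_ofReal, ← Complex.ofReal_mul,
      Complex.ofReal_re]
    exact mul_lt_mul_of_pos_right (hinv k hk hkl) (by positivity)
  have hne : ∀ k : ℝ, (k : ℂ) ∈ pmapSpectrum (invSubConst R m) → k < l / 2 →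
      End.eigenspace (R : H →ₗ[ℂ] H) (((k + m)⁻¹ : ℝ) : ℂ) ≠ ⊥ := by
    intro k hk hkl
    obtain ⟨-, hkm, hkR⟩ := pmapSpectrum_invSubConst hR hinj hpos hk
    rw [Complex.ofReal_re] at hkm hkR
    obtain ⟨u, hu0, hu⟩ := hn.exists_eigenvector hR (hinv k hkm hkl) hkR
    exact Submodule.ne_bot_iff _ |>.2 ⟨u, End.mem_eigenspace_iff.2 hu, hu0⟩
  have hll : l < l / 2 := by linarith
  refine ⟨?_, ?_, ?_⟩
  · let s : Set ℝ := {k | (k : ℂ) ∈ pmapSpectrum (invSubConst R m) ∧ k < l / 2}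
    have hs : s.Finite := by
      by_contra hinf
      obtain ⟨F, hFs, hFc⟩ := Set.Infinite.exists_subset_card_eq (s := s) hinf (n + 1)
      have hFm : ∀ k ∈ F, 0 < k + m := fun k hk => by
        have := (pmapSpectrum_invSubConst hR hinj hpos (hFs hk).1).2.1
        rwa [Complex.ofReal_re] at this
      have h1 := hn.sum_finrank_eigenspace_le hR F (fun k => (k + m)⁻¹)
        (fun a _ b _ hab => by simpa using hab) (fun k hk => hinv k (hFm k hk) (hFs hk).2)
      have h2 : ∑ k ∈ F, 1 ≤ ∑ k ∈ F,
          finrank ℂ (End.eigenspace (R : H →ₗ[ℂ] H) (((k + m)⁻¹ : ℝ) : ℂ)) := by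
        refine Finset.sum_le_sum fun k hk => ?_
        have := hfin k (hFm k hk) (hFs hk).2
        rw [Nat.one_le_iff_ne_zero]
        exact fun h0 => hne k (hFs hk).1 (hFs hk).2 (Submodule.finrank_eq_zero.1 h0)
      simp only [Finset.sum_const, smul_eq_mul, mul_one, hFc] at h2
      omega
    have hclosed : IsClosed (s \ {l}) := (hs.subset sdiff_subset).isClosed
    have hopen : (s \ {l})ᶜ ∈ 𝓝 l := hclosed.isOpen_compl.mem_nhds (by simp)
    obtain ⟨ε, hε, hball⟩ := Metric.mem_nhds_iff.1 hopen
    refine ⟨min ε (-l / 2), lt_min hε (by linarith), fun z hz hd => ?_⟩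
    have hzr := (pmapSpectrum_invSubConst hR hinj hpos hz).1
    rw [hzr] at hz hd ⊢
    rw [Complex.dist_eq, ← Complex.ofReal_sub, Complex.norm_real, ← dist_eq_norm] at hd
    by_contra hzl
    have hzl' : z.re ≠ l := fun h => hzl (by rw [h])
    refine hball (Metric.mem_ball.2 (hd.trans_le (min_le_left _ _))) ⟨⟨hz, ?_⟩, hzl'⟩
    have := hd.trans_le (min_le_right _ _)
    rw [Real.dist_eq, abs_lt] at this
    linarith [this.2]
  · rw [pmapEigenspace_invSubConst hinj hlm.ne']
    exact hne l hls hll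
  · rw [pmapEigenspace_invSubConst hinj hlm.ne']
    exact hfin l hlm hll

end ResolventOperator

/-! ### Closure of a form and its operator, by a Lax-Milgram argument -/

section FormModel

set_option linter.unusedSectionVars false

open Module

variable {H : Type*} [NormedAddCommGroup H] [InnerProductSpace ℂ H] [CompleteSpace H]
variable {G : Type*} [NormedAddCommGroup G] [InnerProductSpace ℂ G] [CompleteSpace G]
variable {D : Type*} [AddCommGroup D] [Module ℂ D]

/-- The form `q = ‖e ·‖² - ‖r ·‖²` on `D`, realised on a Hilbert space `G` that contains `D` as a
dense subspace and is embedded into `H` by `p`; the part `‖r ·‖²` has relative bound `1/2`. -/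
structure FormModel (j : D →ₗ[ℂ] H) (q : D → ℝ) (i : D →ₗ[ℂ] G) (p e r : G →L[ℂ] H)
    (C : ℝ) : Prop where
  nonneg : 0 ≤ C
  denseRange : DenseRange i
  embed : ∀ u, p (i u) = j u
  form_eq : ∀ u, q u = ‖e (i u)‖ ^ 2 - ‖r (i u)‖ ^ 2
  injective : Function.Injective p
  denseRange_embed : DenseRange p
  bound : ∀ x, ‖r x‖ ^ 2 ≤ 1 / 2 * ‖e x‖ ^ 2 + C * ‖p x‖ ^ 2
  norm_le : ∀ x, ‖x‖ ^ 2 ≤ (C + 2) * (‖p x‖ ^ 2 + ‖e x‖ ^ 2)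

/-- The operator on `G` that represents the form `‖e ·‖² - ‖r ·‖² + m ‖p ·‖²`. -/
def formGram (p e r : G →L[ℂ] H) (m : ℝ) : G →L[ℂ] G :=
  (m : ℂ) • (ContinuousLinearMap.adjoint p).comp p + (ContinuousLinearMap.adjoint e).comp e -
    (ContinuousLinearMap.adjoint r).comp r

theorem inner_formGram (p e r : G →L[ℂ] H) (m : ℝ) (x y : G) :
    inner ℂ (formGram p e r m x) y =
      m * inner ℂ (p x) (p y) + inner ℂ (e x) (e y) - inner ℂ (r x) (r y) := by
  simp [formGram, ContinuousLinearMap.adjoint_inner_left]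

/-- The solution `x` of `‖e ·‖² - ‖r ·‖² + m ‖p ·‖² (x, y) = ⟨f, p y⟩`. -/
def formSolve (p e r : G →L[ℂ] H) (m : ℝ) : H →L[ℂ] G :=
  (Ring.inverse (formGram p e r m)).comp (ContinuousLinearMap.adjoint p)

/-- The resolvent `f ↦ p x` of the operator of the form. -/
def formResolvent (p e r : G →L[ℂ] H) (m : ℝ) : H →L[ℂ] H := p.comp (formSolve p e r m)

namespace FormModel

variable {j : D →ₗ[ℂ] H} {q : D → ℝ} {i : D →ₗ[ℂ] G} {p e r : G →L[ℂ] H} {C : ℝ}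

/-- The shift `C + 1` absorbs the lower order term `C ‖p x‖²` of the relative bound and leaves half
of `‖p x‖² + ‖e x‖²`, which controls `‖x‖²`. -/
theorem coercive (M : FormModel j q i p e r C) (x : G) :
    ‖x‖ ^ 2 * (2 * (C + 2))⁻¹ ≤ (inner ℂ (formGram p e r (C + 1) x) x).re := by
  have hC := M.nonneg
  have h : (inner ℂ (formGram p e r (C + 1) x) x).re =
      (C + 1) * ‖p x‖ ^ 2 + ‖e x‖ ^ 2 - ‖r x‖ ^ 2 := by
    rw [inner_formGram, inner_self_eq_ofReal, inner_self_eq_ofReal, inner_self_eq_ofReal,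
      ← Complex.ofReal_mul, ← Complex.ofReal_add, ← Complex.ofReal_sub, Complex.ofReal_re]
  rw [h, ← div_eq_mul_inv, div_le_iff₀ (by positivity)]
  have h1 := M.bound x
  have h2 := M.norm_le x
  have h3 : 1 / 2 * (‖p x‖ ^ 2 + ‖e x‖ ^ 2) ≤ (C + 1) * ‖p x‖ ^ 2 + ‖e x‖ ^ 2 - ‖r x‖ ^ 2 := by
    nlinarith [sq_nonneg ‖p x‖]
  nlinarith [mul_le_mul_of_nonneg_right h3 (by positivity : 0 ≤ 2 * (C + 2))]

theorem isUnit_formGram (M : FormModel j q i p e r C) : IsUnit (formGram p e r (C + 1)) := by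
  have hC := M.nonneg
  have hpos : 0 < (2 * (C + 2))⁻¹ := by positivity
  refine ContinuousLinearMap.isUnit_of_forall_le_norm_inner_map _ (Real.toNNReal_pos.2 hpos)
    fun x => ?_
  rw [Real.coe_toNNReal _ hpos.le]
  exact (M.coercive x).trans (Complex.re_le_norm _)

theorem formGram_formSolve (M : FormModel j q i p e r C) (f : H) :
    formGram p e r (C + 1) (formSolve p e r (C + 1) f) = ContinuousLinearMap.adjoint p f :=
  congrArg (fun T : G →L[ℂ] G => T (ContinuousLinearMap.adjoint p f))
    (Ring.mul_inverse_cancel _ M.isUnit_formGram)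

theorem inner_formSolve (M : FormModel j q i p e r C) (f : H) (y : G) :
    inner ℂ (formGram p e r (C + 1) (formSolve p e r (C + 1) f)) y = inner ℂ f (p y) := by
  rw [M.formGram_formSolve, ContinuousLinearMap.adjoint_inner_left]

theorem eq_formSolve (M : FormModel j q i p e r C) {x : G} {f : H}
    (h : ∀ y, inner ℂ (formGram p e r (C + 1) x) y = inner ℂ f (p y)) :
    x = formSolve p e r (C + 1) f := by
  have h1 : formGram p e r (C + 1) x = ContinuousLinearMap.adjoint p f :=
    ext_inner_right ℂ fun y => by rw [h, ContinuousLinearMap.adjoint_inner_left]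
  have h2 := congrArg (fun T : G →L[ℂ] G => T x)
    (Ring.inverse_mul_cancel _ M.isUnit_formGram)
  change Ring.inverse (formGram p e r (C + 1)) (formGram p e r (C + 1) x) = x at h2
  rw [← h2, h1]
  rfl

theorem isSelfAdjoint_formResolvent (M : FormModel j q i p e r C) :
    IsSelfAdjoint (formResolvent p e r (C + 1)) := by
  refine ContinuousLinearMap.isSelfAdjoint_iff_isSymmetric.2 fun f g => ?_
  change inner ℂ (p (formSolve p e r (C + 1) f)) g = inner ℂ f (p (formSolve p e r (C + 1) g))
  rw [← M.inner_formSolve, ← inner_conj_symm, ← M.inner_formSolve, inner_formGram,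
    inner_formGram]
  simp [inner_conj_symm]

theorem inner_formResolvent (M : FormModel j q i p e r C) (f : H) :
    inner ℂ (formResolvent p e r (C + 1) f) f =
      inner ℂ (formGram p e r (C + 1) (formSolve p e r (C + 1) f)) (formSolve p e r (C + 1) f) := by
  rw [M.inner_formSolve]
  exact ContinuousLinearMap.isSelfAdjoint_iff_isSymmetric.1 M.isSelfAdjoint_formResolvent f f

theorem formResolvent_nonneg (M : FormModel j q i p e r C) (f : H) :
    0 ≤ (inner ℂ (formResolvent p e r (C + 1) f) f).re := by
  have hC := M.nonneg
  rw [M.inner_formResolvent]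
  exact le_trans (by positivity) (M.coercive _)

theorem injective_formSolve (M : FormModel j q i p e r C) :
    Function.Injective (formSolve p e r (C + 1)) := by
  refine (injective_iff_map_eq_zero _).2 fun f hf => ?_
  refine M.denseRange_embed.eq_zero_of_inner_left ℂ ?_
  intro y
  rw [← M.inner_formSolve, hf, map_zero, inner_zero_left]

theorem injective_formResolvent (M : FormModel j q i p e r C) :
    Function.Injective (formResolvent p e r (C + 1)) :=
  M.injective.comp M.injective_formSolve

theorem form_le (M : FormModel j q i p e r C) (u : D) :
    ‖e (i u)‖ ^ 2 ≤ 2 * q u + 2 * C * ‖j u‖ ^ 2 := by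
  have := M.bound (i u)
  rw [M.form_eq, ← M.embed]
  linarith

theorem semibounded (M : FormModel j q i p e r C) : FormSemibounded j q :=
  ⟨-C, fun u => by have := M.form_le u; nlinarith [sq_nonneg ‖e (i u)‖]⟩

/-- The relative bound gives `‖e ·‖² ≤ 2 q + 2 C ‖j ·‖²`, so a `q`-convergent sequence is Cauchy in
the norm of `G`. Injectivity of `p` then turns this description into closability. -/
theorem formConverges_iff (M : FormModel j q i p e r C) {s : ℕ → D} {u : H} :
    FormConverges j q s u ↔ ∃ x : G, p x = u ∧ Tendsto (fun n => i (s n)) atTop (𝓝 x) := by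
  have hC := M.nonneg
  constructor
  · rintro ⟨h1, h2⟩
    have hj : Tendsto (fun n : ℕ × ℕ => ‖j (s n.1 - s n.2)‖ ^ 2) atTop (𝓝 0) := by
      have ha : Tendsto (fun n : ℕ × ℕ => j (s n.1 - s n.2)) atTop (𝓝 0) := by
        have h3 : Tendsto (fun n : ℕ × ℕ => j (s n.1)) atTop (𝓝 u) :=
          h1.comp (by rw [← prod_atTop_atTop_eq]; exact tendsto_fst)
        have h4 : Tendsto (fun n : ℕ × ℕ => j (s n.2)) atTop (𝓝 u) :=
          h1.comp (by rw [← prod_atTop_atTop_eq]; exact tendsto_snd)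
        simpa using h3.sub h4
      simpa using ha.norm.pow 2
    have hi : Tendsto (fun n : ℕ × ℕ => ‖i (s n.1 - s n.2)‖ ^ 2) atTop (𝓝 0) := by
      refine squeeze_zero (g := fun n : ℕ × ℕ => (C + 2) * (‖j (s n.1 - s n.2)‖ ^ 2 +
        (2 * q (s n.1 - s n.2) + 2 * C * ‖j (s n.1 - s n.2)‖ ^ 2)))
        (fun n => by positivity) (fun n => ?_) ?_
      · refine (M.norm_le _).trans ?_
        rw [M.embed]
        have := M.form_le (s n.1 - s n.2)
        gcongr
      · simpa using (hj.add ((h2.const_mul 2).add (hj.const_mul (2 * C)))).const_mul (C + 2)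
    have hcauchy : CauchySeq (fun n => i (s n)) := by
      rw [cauchySeq_iff_tendsto_dist_atTop_0]
      have := hi.sqrt
      simp only [Real.sqrt_zero] at this
      refine this.congr fun n => ?_
      rw [Real.sqrt_sq (norm_nonneg _), map_sub, dist_eq_norm]
    obtain ⟨x, hx⟩ := cauchySeq_tendsto_of_complete hcauchy
    refine ⟨x, ?_, hx⟩
    refine tendsto_nhds_unique ((p.continuous.tendsto x).comp hx) (h1.congr fun n => ?_)
    exact (M.embed _).symm
  · rintro ⟨x, rfl, hx⟩
    refine ⟨((p.continuous.tendsto x).comp hx).congr fun n => M.embed _, ?_⟩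
    have h3 : Tendsto (fun n : ℕ × ℕ => i (s n.1 - s n.2)) atTop (𝓝 0) := by
      have h3 : Tendsto (fun n : ℕ × ℕ => i (s n.1)) atTop (𝓝 x) :=
        hx.comp (by rw [← prod_atTop_atTop_eq]; exact tendsto_fst)
      have h4 : Tendsto (fun n : ℕ × ℕ => i (s n.2)) atTop (𝓝 x) :=
        hx.comp (by rw [← prod_atTop_atTop_eq]; exact tendsto_snd)
      simpa using h3.sub h4
    have he := ((e.continuous.tendsto 0).comp h3).norm.pow 2
    have hr := ((r.continuous.tendsto 0).comp h3).norm.pow 2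
    have := he.sub hr
    simp only [map_zero, norm_zero, sub_self] at this
    exact this.congr fun n => (M.form_eq _).symm

theorem tendsto_form (M : FormModel j q i p e r C) {s : ℕ → D} {x : G}
    (h : Tendsto (fun n => i (s n)) atTop (𝓝 x)) :
    Tendsto (fun n => q (s n)) atTop (𝓝 (‖e x‖ ^ 2 - ‖r x‖ ^ 2)) := by
  have he := ((e.continuous.tendsto x).comp h).norm.pow 2
  have hr := ((r.continuous.tendsto x).comp h).norm.pow 2
  exact (he.sub hr).congr fun n => (M.form_eq _).symm

theorem closable (M : FormModel j q i p e r C) : FormClosable j q := by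
  intro s hs
  obtain ⟨x, hx0, hx⟩ := M.formConverges_iff.1 hs
  have : x = 0 := M.injective (by rw [hx0, map_zero])
  subst this
  simpa using M.tendsto_form hx

/-- The inverse of the embedding `p`, on its range. -/
def lift (M : FormModel j q i p e r C) : LinearMap.range (p : G →ₗ[ℂ] H) →ₗ[ℂ] G :=
  (LinearEquiv.ofInjective (p : G →ₗ[ℂ] H) M.injective).symm

theorem embed_lift (M : FormModel j q i p e r C) (u : LinearMap.range (p : G →ₗ[ℂ] H)) :
    p (M.lift u) = u :=
  congrArg Subtype.val ((LinearEquiv.ofInjective (p : G →ₗ[ℂ] H) M.injective).apply_symm_apply u)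

theorem lift_eq (M : FormModel j q i p e r C) {u : LinearMap.range (p : G →ₗ[ℂ] H)} {x : G}
    (h : p x = u) : M.lift u = x :=
  M.injective ((M.embed_lift u).trans h.symm)

/-- The closure of the form, with domain the range of `p`. -/
def closedForm (M : FormModel j q i p e r C) :
    LinearMap.range (p : G →ₗ[ℂ] H) →ₗ⋆[ℂ] LinearMap.range (p : G →ₗ[ℂ] H) →ₗ[ℂ] ℂ :=
  LinearMap.mk₂'ₛₗ (starRingEnd ℂ) (RingHom.id ℂ)
    (fun u v => inner ℂ (e (M.lift u)) (e (M.lift v)) - inner ℂ (r (M.lift u)) (r (M.lift v)))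
    (fun u u' v => by simp only [map_add, inner_add_left]; ring)
    (fun c u v => by simp only [map_smul, inner_smul_left, smul_eq_mul]; ring)
    (fun u v v' => by simp only [map_add, inner_add_right]; ring)
    (fun c u v => by simp only [map_smul, inner_smul_right, smul_eq_mul, RingHom.id_apply]; ring)

theorem closedForm_apply (M : FormModel j q i p e r C) (u v : LinearMap.range (p : G →ₗ[ℂ] H)) :
    M.closedForm u v =
      inner ℂ (e (M.lift u)) (e (M.lift v)) - inner ℂ (r (M.lift u)) (r (M.lift v)) := rfl

theorem isFormClosure (M : FormModel j q i p e r C) :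
    IsFormClosure j q (LinearMap.range (p : G →ₗ[ℂ] H)) M.closedForm where
  mem_domain_iff u := by
    simp_rw [M.formConverges_iff]
    constructor
    · rintro ⟨x, rfl⟩
      obtain ⟨y, hy, hlim⟩ := mem_closure_iff_seq_limit.1 (M.denseRange x)
      choose s hs using hy
      exact ⟨s, x, rfl, by simpa only [hs] using hlim⟩
    · rintro ⟨s, x, hx, -⟩
      exact ⟨x, hx⟩
  tendsto_diag u s hs := by
    obtain ⟨x, hx, hlim⟩ := M.formConverges_iff.1 hs
    rw [closedForm_apply, M.lift_eq hx, inner_self_eq_ofReal, inner_self_eq_ofReal,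
      ← Complex.ofReal_sub]
    exact (Complex.continuous_ofReal.tendsto _).comp (M.tendsto_form hlim)

theorem isFormOperator (M : FormModel j q i p e r C) :
    IsFormOperator (LinearMap.range (p : G →ₗ[ℂ] H)) M.closedForm
      (invSubConst (formResolvent p e r (C + 1)) (C + 1)) := by
  intro u f
  rw [mem_invSubConst_graph M.injective_formResolvent]
  have key : ∀ (x : G) (hx : p x = u) (y : G),
      inner ℂ (formGram p e r (C + 1) x) y - inner ℂ (f + ((C + 1 : ℝ) : ℂ) • u) (p y) =
        inner ℂ (e x) (e y) - inner ℂ (r x) (r y) - inner ℂ f (p y) := by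
    intro x hx y
    rw [inner_formGram, inner_add_left, inner_smul_left, hx, Complex.conj_ofReal]
    ring
  constructor
  · intro h
    refine ⟨⟨_, h⟩, fun v => ?_⟩
    set x := formSolve p e r (C + 1) (f + ((C + 1 : ℝ) : ℂ) • u) with hxdef
    have hx : p x = u := h
    have h1 := key x hx (M.lift v)
    rw [hxdef, M.inner_formSolve, sub_self, ← hxdef, M.embed_lift] at h1
    rw [closedForm_apply, M.lift_eq hx]
    exact (sub_eq_zero.1 h1.symm)
  · rintro ⟨⟨x, hx⟩, h⟩
    have hx' : p x = u := hx
    have h2 : x = formSolve p e r (C + 1) (f + ((C + 1 : ℝ) : ℂ) • u) := by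
      refine M.eq_formSolve fun y => ?_
      have h3 := h ⟨p y, ⟨y, rfl⟩⟩
      rw [closedForm_apply, M.lift_eq hx', M.lift_eq rfl] at h3
      rw [← sub_eq_zero, key x hx' y, h3, sub_self]
    change p (formSolve p e r (C + 1) (f + ((C + 1 : ℝ) : ℂ) • u)) = u
    rw [← h2, hx']

/-- If `q ≥ -E ‖·‖²` on the common kernel of `n` linear functionals, then every family of more
than `n` vectors has a nontrivial combination on which the closed form is `≥ -E ‖·‖²`. -/
theorem exists_combination (M : FormModel j q i p e r C) {E : ℝ} {n N : ℕ} (hN : n < N)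
    (Φ : D →ₗ[ℂ] (Fin n → ℂ)) (hΦ : ∀ u, Φ u = 0 → -E * ‖j u‖ ^ 2 ≤ q u) (x : Fin N → G) :
    ∃ c : Fin N → ℂ, c ≠ 0 ∧ -E * ‖p (∑ k, c k • x k)‖ ^ 2 ≤
      ‖e (∑ k, c k • x k)‖ ^ 2 - ‖r (∑ k, c k • x k)‖ ^ 2 := by
  have hseq : ∀ k, ∃ s : ℕ → D, Tendsto (fun n => i (s n)) atTop (𝓝 (x k)) := by
    intro k
    obtain ⟨y, hy, hlim⟩ := mem_closure_iff_seq_limit.1 (M.denseRange (x k))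
    choose s hs using hy
    exact ⟨s, by simpa only [hs] using hlim⟩
  choose s hs using hseq
  -- `Φ` is defined on `D` only and need not be continuous in the norm of `G`. The combination is
  -- therefore chosen for approximants in `D`, with coefficients normalised so that compactness of
  -- the unit sphere gives a nonzero limit.
  have hc : ∀ a : ℕ, ∃ c : Fin N → ℂ, c ∈ Metric.sphere (0 : Fin N → ℂ) 1 ∧
      Φ (∑ k, c k • s k a) = 0 := by
    intro a
    let L : (Fin N → ℂ) →ₗ[ℂ] (Fin n → ℂ) :=
      Φ ∘ₗ (∑ k, (LinearMap.proj k : (Fin N → ℂ) →ₗ[ℂ] ℂ).smulRight (s k a))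
    have hker : LinearMap.ker L ≠ ⊥ := LinearMap.ker_ne_bot_of_finrank_lt (by simpa using hN)
    obtain ⟨c, hc, hc0⟩ := Submodule.exists_mem_ne_zero_of_ne_bot hker
    refine ⟨((‖c‖⁻¹ : ℝ) : ℂ) • c, ?_, ?_⟩
    · rw [mem_sphere_zero_iff_norm, norm_smul, Complex.norm_real, norm_inv, norm_norm,
        inv_mul_cancel₀ (norm_ne_zero_iff.2 hc0)]
    · have h1 : L c = 0 := hc
      simp only [L, LinearMap.comp_apply, LinearMap.sum_apply, LinearMap.smulRight_apply,
        LinearMap.proj_apply] at h1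
      simp only [Pi.smul_apply, smul_assoc, ← Finset.smul_sum]
      rw [map_smul, h1, smul_zero]
  choose c hc1 hc2 using hc
  obtain ⟨c0, hc0, φ, hφ, hlim⟩ := (isCompact_sphere (0 : Fin N → ℂ) 1).tendsto_subseq hc1
  have hcomb : Tendsto (fun a => i (∑ k, c (φ a) k • s k (φ a))) atTop
      (𝓝 (∑ k, c0 k • x k)) := by
    simp only [map_sum, map_smul]
    refine tendsto_finsetSum _ fun k _ => ?_
    exact ((tendsto_pi_nhds.1 hlim) k).smul ((hs k).comp hφ.tendsto_atTop)
  refine ⟨c0, fun h0 => ?_, ?_⟩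
  · rw [h0, mem_sphere_zero_iff_norm, norm_zero] at hc0
    exact zero_ne_one hc0
  · refine le_of_tendsto_of_tendsto' (((((p.continuous.tendsto _).comp hcomb).norm.pow 2).const_mul
      (-E))) (M.tendsto_form hcomb) fun a => ?_
    have := hΦ _ (hc2 (φ a))
    rwa [← M.embed] at this

/-- Let `m = C + 1`. Were `W` of dimension above `n`, some nonzero `v` in `W` would have a solution
`x` on which the form is at least `-E ‖p x‖²`. For `ρ = ⟨R v, v⟩` this gives `ρ ≥ (m - E) ‖p x‖²`,
while Cauchy-Schwarz gives `ρ ≤ ‖p x‖ ‖v‖`. Together with `‖v‖² < (m - E) ρ` they yield `ρ² < ρ²`.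
-/
theorem upperIndexLE (M : FormModel j q i p e r C) {E : ℝ} (hE : E < C + 1) {n : ℕ}
    (Φ : D →ₗ[ℂ] (Fin n → ℂ)) (hΦ : ∀ u, Φ u = 0 → -E * ‖j u‖ ^ 2 ≤ q u) :
    UpperIndexLE (formResolvent p e r (C + 1)) (C + 1 - E)⁻¹ n := by
  intro W hWfd hW
  by_contra! hlt
  let w := Module.finBasis ℂ W
  obtain ⟨c, hc0, hc⟩ := M.exists_combination hlt Φ hΦ
    (fun k => formSolve p e r (C + 1) (w k : H))
  set v : W := ∑ k, c k • w k with hv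
  have hv0 : (v : H) ≠ 0 := by
    intro h0
    have h1 : v = 0 := Subtype.ext h0
    exact hc0 (funext fun k => Fintype.linearIndependent_iff.1 w.linearIndependent c
      (by rw [← hv, h1]) k)
  have hsum : ∑ k, c k • formSolve p e r (C + 1) (w k : H) = formSolve p e r (C + 1) (v : H) := by
    rw [hv]; simp
  rw [hsum] at hc
  have hpos := hW v v.2 hv0
  have hval := congrArg Complex.re (M.inner_formResolvent (v : H))
  rw [inner_formGram, inner_self_eq_ofReal, inner_self_eq_ofReal, inner_self_eq_ofReal,
    ← Complex.ofReal_mul, ← Complex.ofReal_add, ← Complex.ofReal_sub, Complex.ofReal_re] at hval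
  set ρ := (inner ℂ (formResolvent p e r (C + 1) (v : H)) (v : H)).re with hρ
  have hcs : ρ ≤ ‖p (formSolve p e r (C + 1) (v : H))‖ * ‖(v : H)‖ :=
    (Complex.re_le_norm _).trans (norm_inner_le_norm _ _)
  have hd : 0 < C + 1 - E := by linarith
  rw [inv_mul_lt_iff₀ hd] at hpos
  set P := ‖p (formSolve p e r (C + 1) (v : H))‖ with hP
  have hvn : 0 < ‖(v : H)‖ := norm_pos_iff.2 hv0
  have hρ0 : 0 < ρ := by
    by_contra! hneg
    nlinarith [pow_pos hvn 2]
  have h1 : (C + 1 - E) * P ^ 2 ≤ ρ := by rw [hval]; linarith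
  have h2 : ρ ^ 2 ≤ P ^ 2 * ‖(v : H)‖ ^ 2 := by
    rw [← mul_pow]; exact pow_le_pow_left₀ hρ0.le hcs 2
  have hP2 : 0 < P ^ 2 := by
    by_contra! hneg
    nlinarith [pow_pos hvn 2, pow_pos hρ0 2, sq_nonneg P]
  have h3 : P ^ 2 * ‖(v : H)‖ ^ 2 < P ^ 2 * ((C + 1 - E) * ρ) := mul_lt_mul_of_pos_left hpos hP2
  have h4 : P ^ 2 * ((C + 1 - E) * ρ) ≤ ρ * ρ := by nlinarith
  nlinarith

end FormModel

end FormModel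

/-! ### From counting eigenvalues to the trace bound -/

section Trace

open Module

/-- The layer cake formula for the two counting measures writes both sums as integrals of the
counting functions against the same weight in `t`. -/
theorem sum_rpow_le_of_card_le {X : Type*} [Finite X] (f : X → ℝ) (hf : ∀ x, 0 ≤ f x) (a : ℕ → ℝ)
    (ha : ∀ k, 0 ≤ a k) {γ : ℝ} (hγ : 0 < γ)
    (h : ∀ t : ℝ, 0 < t → {x | t < f x}.encard ≤ 2 * {k | t < a k}.encard) :
    ∑' x, ENNReal.ofReal (f x ^ γ) ≤ 2 * ∑' k, ENNReal.ofReal (a k ^ γ) := by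
  let : MeasurableSpace X := ⊤
  have hX := lintegral_rpow_eq_lintegral_meas_lt_mul (Measure.count : Measure X)
    (Filter.Eventually.of_forall hf) (measurable_from_top.aemeasurable) hγ
  have hN := lintegral_rpow_eq_lintegral_meas_lt_mul (Measure.count : Measure ℕ)
    (Filter.Eventually.of_forall ha) (measurable_from_top.aemeasurable) hγ
  rw [lintegral_count] at hX hN
  rw [hX, hN, mul_left_comm, ← lintegral_const_mul' 2 _ (by simp)]
  refine mul_le_mul_right (setLIntegral_mono' (measurableSet_Ioi (α := ℝ)) fun t ht => ?_) _
  rw [← mul_assoc]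
  refine mul_le_mul_left ?_ _
  rw [Measure.count_apply (MeasurableSet.of_discrete), Measure.count_apply (MeasurableSet.of_discrete)]
  exact_mod_cast h t ht

variable {H : Type*} [NormedAddCommGroup H] [InnerProductSpace ℂ H] [CompleteSpace H]

theorem traceNegPow_invSubConst_le {R : H →L[ℂ] H} {m : ℝ} (hR : IsSelfAdjoint R)
    (hinj : Function.Injective R) (hpos : ∀ f, 0 ≤ (inner ℂ (R f) f).re) {a : ℕ → ℝ}
    (ha : ∀ k, 0 ≤ a k) (hfin : ∀ E : ℝ, 0 < E → {k | E < a k}.Finite)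
    (hidx : ∀ E : ℝ, 0 < E → E < m → UpperIndexLE R (m - E)⁻¹ (2 * {k | E < a k}.ncard))
    {γ : ℝ} (hγ : 0 < γ) :
    traceNegPow (invSubConst R m) γ ≤ 2 * ∑' k, ENNReal.ofReal (a k ^ γ) := by
  have hdisc := discreteNegativeSpectrum_invSubConst hR hinj hpos
    fun E h1 h2 => ⟨_, hidx E h1 h2⟩
  rw [traceNegPow, ENNReal.tsum_eq_iSup_sum]
  refine iSup_le fun F => ?_
  classical
  let F' : Finset (Iio (0 : ℝ)) := F.filter fun l : Iio (0 : ℝ) =>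
    pmapEigenspace (invSubConst R m) ((l : ℝ) : ℂ) ≠ ⊥
  have hF' : ∀ l ∈ F', 0 < (l : ℝ) + m ∧
      FiniteDimensional ℂ (pmapEigenspace (invSubConst R m) ((l : ℝ) : ℂ)) := by
    intro l hl
    have hs := mem_pmapSpectrum_of_eigenspace_ne_bot (Finset.mem_filter.1 hl).2
    refine ⟨?_, (hdisc l l.2 hs).2.2⟩
    have := (pmapSpectrum_invSubConst hR hinj hpos hs).2.1
    rwa [Complex.ofReal_re] at this
  let d : Iio (0 : ℝ) → ℕ := fun l => finrank ℂ (pmapEigenspace (invSubConst R m) ((l : ℝ) : ℂ))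
  have hsum : ∑ l ∈ F, ((Cardinal.toENat (Module.rank ℂ
      (pmapEigenspace (invSubConst R m) ((l : ℝ) : ℂ))) : ℕ∞) : ℝ≥0∞) *
        ENNReal.ofReal (|(l : ℝ)| ^ γ) = ∑ l ∈ F', (d l : ℝ≥0∞) * ENNReal.ofReal (|(l : ℝ)| ^ γ) := by
    have hzero : ∀ l ∈ F, ((Cardinal.toENat (Module.rank ℂ
        (pmapEigenspace (invSubConst R m) ((l : ℝ) : ℂ))) : ℕ∞) : ℝ≥0∞) *
          ENNReal.ofReal (|(l : ℝ)| ^ γ) ≠ 0 →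
            pmapEigenspace (invSubConst R m) ((l : ℝ) : ℂ) ≠ ⊥ := by
      intro l _ hne hbot
      apply hne
      rw [hbot]
      simp
    rw [← Finset.sum_filter_of_ne hzero]
    refine Finset.sum_congr rfl fun l hl => ?_
    have := (hF' l hl).2
    rw [← Module.finrank_eq_rank, map_natCast]
    simp [d]
  rw [hsum]
  -- One point for each eigenvalue counted with multiplicity.
  let X := Σ l : F', Fin (d l)
  have hX := sum_rpow_le_of_card_le (X := X) (fun x => |((x.1 : Iio (0 : ℝ)) : ℝ)|)
    (fun x => abs_nonneg _) a ha hγ (by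
      intro t ht
      have hset : {x : X | t < |((x.1 : Iio (0 : ℝ)) : ℝ)|} =
          (((Finset.univ.filter fun l : F' => t < |((l : Iio (0 : ℝ)) : ℝ)|).sigma
            fun _ => Finset.univ : Finset X) : Set X) := by
        ext x
        rw [Finset.mem_coe]
        exact ⟨fun h => Finset.mem_sigma.2
            ⟨Finset.mem_filter.2 ⟨Finset.mem_univ _, h⟩, Finset.mem_univ _⟩,
          fun h => (Finset.mem_filter.1 (Finset.mem_sigma.1 h).1).2⟩
      rw [hset, Set.encard_coe_eq_coe_finsetCard, Finset.card_sigma]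
      simp only [Finset.card_univ, Fintype.card_fin]
      rw [← (hfin t ht).cast_ncard_eq]
      have hFt : ∑ l ∈ (Finset.univ.filter fun l : F' => t < |((l : Iio (0 : ℝ)) : ℝ)| : Finset F'), d l ≤
          2 * {k | t < a k}.ncard := by
        have hlt : ∀ l : F', t < |((l : Iio (0 : ℝ)) : ℝ)| → ((l : Iio (0 : ℝ)) : ℝ) < -t := by
          intro l hl
          rw [abs_of_neg l.1.2] at hl
          linarith
        by_cases htm : t < m
        · refine le_trans (le_of_eq ?_) ((hidx t ht htm).sum_finrank_eigenspace_le hR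
            (Finset.univ.filter fun l : F' => t < |((l : Iio (0 : ℝ)) : ℝ)|)
            (fun l => (((l : Iio (0 : ℝ)) : ℝ) + m)⁻¹) ?_ ?_)
          · refine Finset.sum_congr rfl fun l hl => ?_
            simp only [d]
            rw [pmapEigenspace_invSubConst hinj (hF' l l.2).1.ne']
          · intro x _ y _ hxy
            exact Subtype.ext (Subtype.ext (by simpa using hxy))
          · intro l hl
            have := hlt l (Finset.mem_filter.1 hl).2
            exact inv_strictAnti₀ (hF' l l.2).1 (by linarith)
        -- For `t ≥ m` nothing is to be counted, since every eigenvalue exceeds `-m`.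
        · rw [Finset.sum_eq_zero]
          · exact Nat.zero_le _
          · intro l hl
            have h1 := hlt l (Finset.mem_filter.1 hl).2
            have h2 := (hF' l l.2).1
            linarith
      exact_mod_cast hFt)
  refine le_trans (le_of_eq ?_) hX
  rw [tsum_fintype, Fintype.sum_sigma, ← Finset.sum_coe_sort]
  simp

/-- Only the pairs of conditions with index in `{k | E < a k}` are imposed at level `E`, so the
number of functionals is twice the counting function of the sequence `a`. -/
theorem FormModel.traceNegPow_le {G D : Type*} [NormedAddCommGroup G] [InnerProductSpace ℂ G]
    [CompleteSpace G] [AddCommGroup D] [Module ℂ D] {j : D →ₗ[ℂ] H} {q : D → ℝ} {i : D →ₗ[ℂ] G}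
    {p e r : G →L[ℂ] H} {C : ℝ} (M : FormModel j q i p e r C) {a : ℕ → ℝ} (ha : ∀ k, 0 ≤ a k)
    (hfin : ∀ E : ℝ, 0 < E → {k | E < a k}.Finite) (φ : ℕ → D →ₗ[ℂ] (Fin 2 → ℂ))
    (hφ : ∀ E : ℝ, 0 < E → ∀ u, (∀ k, E < a k → φ k u = 0) → -E * ‖j u‖ ^ 2 ≤ q u)
    {γ : ℝ} (hγ : 0 < γ) :
    DiscreteNegativeSpectrum (invSubConst (formResolvent p e r (C + 1)) (C + 1)) ∧
    traceNegPow (invSubConst (formResolvent p e r (C + 1)) (C + 1)) γ ≤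
      2 * ∑' k, ENNReal.ofReal (a k ^ γ) := by
  have hidx : ∀ E : ℝ, 0 < E → E < C + 1 →
      UpperIndexLE (formResolvent p e r (C + 1)) (C + 1 - E)⁻¹ (2 * {k | E < a k}.ncard) := by
    intro E hE hEm
    have := (hfin E hE).fintype
    let eq : ({k | E < a k} → Fin 2 → ℂ) ≃ₗ[ℂ] (Fin (2 * {k | E < a k}.ncard) → ℂ) :=
      LinearEquiv.ofFinrankEq _ _ (by
        rw [Module.finrank_pi_fintype]
        simp [mul_comm])
    refine M.upperIndexLE hEm (eq.toLinearMap ∘ₗ LinearMap.pi fun k => φ k) fun u hu => ?_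
    refine hφ E hE u fun k hk => ?_
    have h1 : (LinearMap.pi fun k : {k | E < a k} => φ k) u = 0 := eq.map_eq_zero_iff.1 hu
    exact congrFun h1 ⟨k, hk⟩
  exact ⟨discreteNegativeSpectrum_invSubConst M.isSelfAdjoint_formResolvent
      M.injective_formResolvent M.formResolvent_nonneg fun E h1 h2 => ⟨_, hidx E h1 h2⟩,
    traceNegPow_invSubConst_le M.isSelfAdjoint_formResolvent M.injective_formResolvent
      M.formResolvent_nonneg ha hfin hidx hγ⟩

end Trace

/-! ### The differential expression as an operator on test functions -/

section TestFunctionCalculus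

theorem testFunction_eq_zero (u : 𝓓(halfLine, ℂ)) {x : ℝ} (hx : x ≤ 0) : u x = 0 := by
  refine image_eq_zero_of_notMem_tsupport fun h => ?_
  exact absurd (u.tsupport_subset h) (not_lt.2 hx)

/-- Multiplication by `x ^ s` on `C₀^∞(0, ∞)`. -/
def mulRpow (s : ℝ) : 𝓓(halfLine, ℂ) →ₗ[ℂ] 𝓓(halfLine, ℂ) where
  toFun u := ⟨fun x => (x ^ s : ℝ) • u x, by
      rw [contDiff_iff_contDiffAt]
      intro x
      -- The power may fail to be smooth at `0`, but the test function vanishes near every `x ≤ 0`.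
      rcases le_or_gt x 0 with hx | hx
      · have h0 : (u : ℝ → ℂ) =ᶠ[𝓝 x] 0 := notMem_tsupport_iff_eventuallyEq.1
          fun h => absurd (u.tsupport_subset h) (not_lt.2 hx)
        refine (contDiffAt_const (c := (0 : ℂ))).congr_of_eventuallyEq ?_
        filter_upwards [h0] with y hy
        rw [hy]; simp
      · exact (Real.contDiffAt_rpow_const_of_ne hx.ne').smul u.contDiff.contDiffAt,
    HasCompactSupport.smul_left (f := fun x : ℝ => x ^ s) u.hasCompactSupport,
    (tsupport_smul_subset_right (fun x : ℝ => x ^ s) u).trans u.tsupport_subset⟩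
  map_add' u v := by ext x; exact smul_add _ _ _
  map_smul' c u := by ext x; exact smul_comm (x ^ s : ℝ) c (u x)

theorem mulRpow_apply (s : ℝ) (u : 𝓓(halfLine, ℂ)) (x : ℝ) :
    mulRpow s u x = (x ^ s : ℝ) • u x := rfl

/-- Differentiation on `C₀^∞(0, ∞)`. -/
def testDeriv : 𝓓(halfLine, ℂ) →ₗ[ℂ] 𝓓(halfLine, ℂ) where
  toFun u := ⟨deriv u, (contDiff_infty_iff_deriv.1 u.contDiff).2, u.hasCompactSupport.deriv,
    (closure_mono (support_deriv_subset (f := u))).trans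
      ((isClosed_tsupport _).closure_eq.subset.trans u.tsupport_subset)⟩
  map_add' u v := by
    ext x
    exact deriv_add (u.contDiff.differentiable (by simp) x) (v.contDiff.differentiable (by simp) x)
  map_smul' c u := by
    ext x
    exact deriv_const_smul c (u.contDiff.differentiable (by simp) x)

theorem hasDerivAt_testDeriv (u : 𝓓(halfLine, ℂ)) (x : ℝ) : HasDerivAt u (testDeriv u x) x :=
  (u.contDiff.differentiable (by simp) x).hasDerivAt

/-- `x^{-β} u`. -/
def quotFn (β : ℝ) : 𝓓(halfLine, ℂ) →ₗ[ℂ] 𝓓(halfLine, ℂ) := mulRpow (-β)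

/-- `x^{-α} (x^{-β} u)'`. -/
def quotDeriv (α β : ℝ) : 𝓓(halfLine, ℂ) →ₗ[ℂ] 𝓓(halfLine, ℂ) :=
  mulRpow (-α) ∘ₗ testDeriv ∘ₗ quotFn β

/-- `x^{α+β} (x^{-α} (x^{-β} u)')'`. -/
def diffOp (α β : ℝ) : 𝓓(halfLine, ℂ) →ₗ[ℂ] 𝓓(halfLine, ℂ) :=
  mulRpow (α + β) ∘ₗ testDeriv ∘ₗ quotDeriv α β

theorem weightedSecondDeriv_eq (α β : ℝ) (u : 𝓓(halfLine, ℂ)) (x : ℝ) :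
    weightedSecondDeriv α β u x = testDeriv (quotDeriv α β u) x := by
  have h0 : ∀ (s : ℝ) (v : 𝓓(halfLine, ℂ)), (fun t : ℝ => (1 / t ^ s) • v t) = mulRpow (-s) v := by
    intro s v
    funext t
    rw [mulRpow_apply]
    rcases le_or_gt t 0 with ht | ht
    · rw [testFunction_eq_zero v ht, smul_zero, smul_zero]
    · rw [Real.rpow_neg ht.le, one_div]
  unfold weightedSecondDeriv
  rw [h0 β u]
  exact congrArg (fun f => deriv f x) (h0 α (testDeriv (quotFn β u)))

theorem norm_diffOp_sq (α β : ℝ) (u : 𝓓(halfLine, ℂ)) {x : ℝ} (hx : 0 < x) :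
    ‖diffOp α β u x‖ ^ 2 = ‖weightedSecondDeriv α β u x‖ ^ 2 * x ^ (2 * (α + β)) := by
  change ‖mulRpow (α + β) (testDeriv (quotDeriv α β u)) x‖ ^ 2 = _
  rw [weightedSecondDeriv_eq, mulRpow_apply, norm_smul, mul_pow, Real.norm_eq_abs, sq_abs, mul_comm,
    mul_comm 2, Real.rpow_mul hx.le]
  norm_num

theorem testDeriv_quotFn (α β : ℝ) (u : 𝓓(halfLine, ℂ)) {x : ℝ} (hx : 0 < x) :
    testDeriv (quotFn β u) x = (x ^ α : ℝ) • quotDeriv α β u x := by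
  change _ = (x ^ α : ℝ) • mulRpow (-α) (testDeriv (quotFn β u)) x
  rw [mulRpow_apply, smul_smul, ← Real.rpow_add hx]
  simp

theorem testDeriv_quotDeriv (α β : ℝ) (u : 𝓓(halfLine, ℂ)) {x : ℝ} (hx : 0 < x) :
    testDeriv (quotDeriv α β u) x = (x ^ (-(α + β)) : ℝ) • diffOp α β u x := by
  change _ = (x ^ (-(α + β)) : ℝ) • mulRpow (α + β) (testDeriv (quotDeriv α β u)) x
  rw [mulRpow_apply, smul_smul, ← Real.rpow_add hx]
  simp

theorem eq_rpow_smul_quotFn (β : ℝ) (u : 𝓓(halfLine, ℂ)) {x : ℝ} (hx : 0 < x) :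
    u x = (x ^ β : ℝ) • quotFn β u x := by
  change _ = (x ^ β : ℝ) • mulRpow (-β) u x
  rw [mulRpow_apply, smul_smul, ← Real.rpow_add hx]
  simp

end TestFunctionCalculus

/-! ### Test functions in `L²`: density, integration by parts, closability -/

section Embedding

theorem testFunction_integral_eq (f : ℝ → ℂ) (hf : ∀ x ≤ 0, f x = 0) :
    ∫ x in Ioi (0 : ℝ), f x = ∫ x, f x :=
  setIntegral_eq_integral_of_forall_compl_eq_zero fun x hx => hf x (not_lt.1 hx)

theorem testToL2_ae (u : 𝓓(halfLine, ℂ)) :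
    (testToL2 u : ℝ → ℂ) =ᵐ[volume.restrict (Ioi (0 : ℝ))] u :=
  (testFunction_memLp u).coeFn_toLp

theorem inner_testToL2_left (u : 𝓓(halfLine, ℂ)) (h : L2HalfLine) :
    inner ℂ (testToL2 u) h = ∫ x in Ioi (0 : ℝ), inner ℂ (u x) (h x) := by
  rw [L2.inner_def]
  refine integral_congr_ae ?_
  filter_upwards [testToL2_ae u] with x hx
  rw [hx]

theorem inner_testToL2 (u v : 𝓓(halfLine, ℂ)) :
    inner ℂ (testToL2 u) (testToL2 v) = ∫ x, star (u x) * v x := by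
  rw [inner_testToL2_left, ← testFunction_integral_eq _ fun x hx => by
    rw [testFunction_eq_zero v hx, mul_zero]]
  refine integral_congr_ae ?_
  filter_upwards [testToL2_ae v] with x hx
  rw [hx, RCLike.inner_apply, mul_comm]
  rfl

theorem norm_testToL2_sq (u : 𝓓(halfLine, ℂ)) :
    ‖testToL2 u‖ ^ 2 = ∫ x in Ioi (0 : ℝ), ‖u x‖ ^ 2 := by
  have h := inner_testToL2_left u (testToL2 u)
  rw [inner_self_eq_ofReal] at h
  have h2 : ∫ x in Ioi (0 : ℝ), inner ℂ (u x) (testToL2 u x) =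
      ((∫ x in Ioi (0 : ℝ), ‖u x‖ ^ 2 : ℝ) : ℂ) := by
    rw [← integral_complex_ofReal]
    refine integral_congr_ae ?_
    filter_upwards [testToL2_ae u] with x hx
    rw [hx, inner_self_eq_ofReal]
  rw [h2] at h
  exact_mod_cast h

theorem inner_testToL2_mulRpow (s : ℝ) (u v : 𝓓(halfLine, ℂ)) :
    inner ℂ (testToL2 u) (testToL2 (mulRpow s v)) =
      inner ℂ (testToL2 (mulRpow s u)) (testToL2 v) := by
  rw [inner_testToL2, inner_testToL2]
  refine integral_congr_ae (Eventually.of_forall fun x => ?_)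
  simp only [mulRpow_apply, Complex.real_smul, star_mul, Complex.star_def, Complex.conj_ofReal]
  ring

theorem integrable_star_mul (u v : 𝓓(halfLine, ℂ)) : Integrable fun x => star (u x) * v x :=
  (u.continuous.star.mul v.continuous).integrable_of_hasCompactSupport v.hasCompactSupport.mul_left

theorem inner_testToL2_testDeriv (u v : 𝓓(halfLine, ℂ)) :
    inner ℂ (testToL2 u) (testToL2 (testDeriv v)) =
      -inner ℂ (testToL2 (testDeriv u)) (testToL2 v) := by
  rw [inner_testToL2, inner_testToL2]
  exact integral_mul_deriv_eq_deriv_mul_of_integrable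
    (fun x _ => (hasDerivAt_testDeriv u x).star) (fun x _ => hasDerivAt_testDeriv v x)
    (integrable_star_mul u (testDeriv v)) (integrable_star_mul (testDeriv u) v)
    (integrable_star_mul u v)

/-- The formal adjoint of `diffOp`. -/
theorem exists_formalAdjoint_diffOp (α β : ℝ) (v : 𝓓(halfLine, ℂ)) :
    ∃ v' : 𝓓(halfLine, ℂ), ∀ u, inner ℂ (testToL2 v) (testToL2 (diffOp α β u)) =
      inner ℂ (testToL2 v') (testToL2 u) := by
  refine ⟨mulRpow (-β) (testDeriv (mulRpow (-α) (testDeriv (mulRpow (α + β) v)))), fun u => ?_⟩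
  simp only [diffOp, quotDeriv, quotFn, LinearMap.comp_apply]
  rw [inner_testToL2_mulRpow, inner_testToL2_testDeriv, inner_testToL2_mulRpow,
    inner_testToL2_testDeriv, neg_neg, inner_testToL2_mulRpow]

theorem eq_zero_of_inner_testToL2 (h : L2HalfLine)
    (h0 : ∀ u : 𝓓(halfLine, ℂ), inner ℂ (testToL2 u) h = 0) : h = 0 := by
  have hint : LocallyIntegrableOn (h : ℝ → ℂ) (Ioi 0) := by
    exact locallyIntegrableOn_of_locallyIntegrable_restrict
      ((Lp.memLp h).locallyIntegrable (by norm_num))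
  have hz := isOpen_Ioi.ae_eq_zero_of_integral_contDiff_smul_eq_zero hint (by
    intro g hg hgc hgs
    let u : 𝓓(halfLine, ℂ) := ⟨fun x => (g x : ℂ),
      Complex.ofRealCLM.contDiff.comp hg, hgc.comp_left (g := fun t : ℝ => (t : ℂ)) (by simp),
      (tsupport_comp_subset (by simp : ((0 : ℝ) : ℂ) = 0) g).trans hgs⟩
    have h1 := h0 u
    rw [inner_testToL2_left] at h1
    rw [← testFunction_integral_eq (fun x => g x • h x) (fun x hx => by
      have : u x = 0 := testFunction_eq_zero u hx
      have : g x = 0 := Complex.ofReal_eq_zero.1 this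
      rw [this, zero_smul]), ← h1]
    refine integral_congr_ae (Eventually.of_forall fun x => ?_)
    change g x • h x = inner ℂ (g x : ℂ) (h x)
    rw [RCLike.inner_apply, Complex.conj_ofReal, Complex.real_smul, mul_comm])
  rw [Lp.eq_zero_iff_ae_eq_zero]
  exact (ae_restrict_iff' measurableSet_Ioi).2 hz

theorem denseRange_testToL2 : DenseRange testToL2 := by
  have : (LinearMap.range testToL2).topologicalClosure = ⊤ := by
    rw [Submodule.topologicalClosure_eq_top_iff, Submodule.eq_bot_iff]
    intro h hh
    exact eq_zero_of_inner_testToL2 h fun u => hh _ ⟨u, rfl⟩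
  exact (Submodule.dense_iff_topologicalClosure_eq_top.2 this)

/-- An operator with a formal adjoint defined on a dense subspace is closable: pair the limit with
test functions and move the operator to the other side. -/
theorem eq_zero_of_tendsto_diffOp (α β : ℝ) {ι : Type*} {l : Filter ι} [l.NeBot]
    {s : ι → 𝓓(halfLine, ℂ)} {h : L2HalfLine} (h1 : Tendsto (fun n => testToL2 (s n)) l (𝓝 0))
    (h2 : Tendsto (fun n => testToL2 (diffOp α β (s n))) l (𝓝 h)) : h = 0 := by
  refine eq_zero_of_inner_testToL2 h fun v => ?_
  obtain ⟨v', hv'⟩ := exists_formalAdjoint_diffOp α β v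
  have h3 := (tendsto_const_nhds (x := testToL2 v)).inner (𝕜 := ℂ) h2
  have h4 := (tendsto_const_nhds (x := testToL2 v')).inner (𝕜 := ℂ) h1
  rw [inner_zero_right] at h4
  exact tendsto_nhds_unique h3 (h4.congr fun n => (hv' _).symm)

end Embedding

/-! ### Weighted Sobolev inequalities on an interval -/

section IntervalEstimates

/-- The primitive `x^{α+1} / (α+1)` of `x^α`. -/
def rpowPrim (α x : ℝ) : ℝ := x ^ (α + 1) / (α + 1)

theorem hasDerivAt_rpowPrim {α : ℝ} (hα : 0 ≤ α) {x : ℝ} (hx : 0 < x) :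
    HasDerivAt (rpowPrim α) (x ^ α) x := by
  have h := (Real.hasDerivAt_rpow_const (p := α + 1) (Or.inl hx.ne')).div_const (α + 1)
  have e : (α + 1) * x ^ (α + 1 - 1) / (α + 1) = x ^ α := by
    rw [add_sub_cancel_right]; field_simp
  rwa [e] at h

theorem rpowPrim_sub_eq {α : ℝ} (hα : 0 ≤ α) (x z : ℝ) :
    rpowPrim α z - rpowPrim α x = ∫ t in x..z, t ^ α := by
  rw [integral_rpow (Or.inl (by linarith)), rpowPrim, rpowPrim, sub_div]

theorem rpowPrim_sub_le {α : ℝ} (hα : 0 ≤ α) {x z : ℝ} (hx : 0 ≤ x) (hxz : x ≤ z) :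
    rpowPrim α z - rpowPrim α x ≤ z ^ α * (z - x) := by
  rw [rpowPrim_sub_eq hα]
  have h := intervalIntegral.integral_mono_on (f := fun t => t ^ α) (g := fun _ => z ^ α) hxz
    (intervalIntegral.intervalIntegrable_rpow' (by linarith)) intervalIntegrable_const
    (fun t ht => Real.rpow_le_rpow (hx.trans ht.1) ht.2 hα)
  rw [intervalIntegral.integral_const, smul_eq_mul] at h
  linarith

theorem le_rpowPrim_sub {α : ℝ} (hα : 0 ≤ α) {x z : ℝ} (hx : 0 ≤ x) (hxz : x ≤ z) :
    x ^ α * (z - x) ≤ rpowPrim α z - rpowPrim α x := by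
  rw [rpowPrim_sub_eq hα]
  have h := intervalIntegral.integral_mono_on (f := fun _ => x ^ α) (g := fun t => t ^ α) hxz
    intervalIntegrable_const (intervalIntegral.intervalIntegrable_rpow' (by linarith))
    (fun t ht => Real.rpow_le_rpow hx ht.1 hα)
  rw [intervalIntegral.integral_const, smul_eq_mul] at h
  linarith

/-- Taylor's formula at the right end point, in the variable `rpowPrim α`. Since `quotFn` has
derivative `z^α` times `quotDeriv`, the derivative of the function in `hderiv` keeps only the term
with the derivative of `quotDeriv`. -/
theorem quotFn_expansion {α β : ℝ} (hα : 0 ≤ α) (u : 𝓓(halfLine, ℂ)) {x b : ℝ} (hx : 0 < x)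
    (hxb : x ≤ b) :
    quotFn β u x = quotFn β u b - (rpowPrim α b - rpowPrim α x) • quotDeriv α β u b +
      ∫ z in x..b, (rpowPrim α z - rpowPrim α x) • testDeriv (quotDeriv α β u) z := by
  have hderiv : ∀ z ∈ uIcc x b, HasDerivAt
      (fun z => quotFn β u z - (rpowPrim α z - rpowPrim α x) • quotDeriv α β u z)
      (-((rpowPrim α z - rpowPrim α x) • testDeriv (quotDeriv α β u) z)) z := by
    intro z hz
    rw [uIcc_of_le hxb] at hz
    have hz0 : 0 < z := hx.trans_le hz.1
    have h1 := hasDerivAt_testDeriv (quotFn β u) z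
    have h2 := ((hasDerivAt_rpowPrim hα hz0).sub_const (rpowPrim α x)).smul
      (hasDerivAt_testDeriv (quotDeriv α β u) z)
    refine (h1.sub h2).congr_deriv ?_
    rw [testDeriv_quotFn α β u hz0]
    abel
  have hcont : ContinuousOn (fun z => rpowPrim α z - rpowPrim α x) (uIcc x b) := by
    intro z hz
    rw [uIcc_of_le hxb] at hz
    exact ((hasDerivAt_rpowPrim hα (hx.trans_le hz.1)).continuousAt.sub
      continuousAt_const).continuousWithinAt
  have hint := intervalIntegral.integral_eq_sub_of_hasDerivAt hderiv
    ((hcont.smul (testDeriv (quotDeriv α β u)).continuous.continuousOn).neg.intervalIntegrable)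
  rw [intervalIntegral.integral_neg] at hint
  rw [sub_self, zero_smul, sub_zero] at hint
  have := neg_eq_iff_eq_neg.1 hint
  rw [this]
  abel

/-- The function in the kernel of the differential expression with the Cauchy data of `u`
at `b`. -/
def kernelPart (α β : ℝ) (u : 𝓓(halfLine, ℂ)) (b x : ℝ) : ℂ :=
  (x ^ β : ℝ) • (quotFn β u b - (rpowPrim α b - rpowPrim α x) • quotDeriv α β u b)

theorem integral_mul_sq_le {a b : ℝ} (hab : a ≤ b) {k h : ℝ → ℝ}
    (hk : IntervalIntegrable (fun z => k z ^ 2) volume a b)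
    (hh : IntervalIntegrable (fun z => h z ^ 2) volume a b)
    (hk' : AEStronglyMeasurable k (volume.restrict (Ioc a b)))
    (hh' : AEStronglyMeasurable h (volume.restrict (Ioc a b))) :
    (∫ z in a..b, k z * h z) ^ 2 ≤ (∫ z in a..b, k z ^ 2) * ∫ z in a..b, h z ^ 2 := by
  rw [intervalIntegral.integral_of_le hab, intervalIntegral.integral_of_le hab,
    intervalIntegral.integral_of_le hab]
  rw [intervalIntegrable_iff_integrableOn_Ioc_of_le hab] at hk hh
  have mk := (memLp_two_iff_integrable_sq hk').2 hk
  have mh := (memLp_two_iff_integrable_sq hh').2 hh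
  have e : ENNReal.ofReal 2 = 2 := by simp
  have h1 := integral_mul_norm_le_Lp_mul_Lq (μ := volume.restrict (Ioc a b)) (f := k) (g := h)
    (p := 2) (q := 2) (Real.holderConjugate_iff.2 ⟨by norm_num, by norm_num⟩)
    (by rwa [e]) (by rwa [e])
  have h2 : |∫ z in Ioc a b, k z * h z| ≤ ∫ z in Ioc a b, ‖k z‖ * ‖h z‖ := by
    rw [← Real.norm_eq_abs]
    refine (norm_integral_le_integral_norm _).trans (le_of_eq ?_)
    simp_rw [norm_mul]
  have h3 := pow_le_pow_left₀ (abs_nonneg _) (h2.trans h1) 2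
  rw [sq_abs, mul_pow] at h3
  refine h3.trans (le_of_eq ?_)
  have h4 : ∀ f : ℝ → ℝ, ((∫ z in Ioc a b, ‖f z‖ ^ (2 : ℝ)) ^ (1 / (2 : ℝ))) ^ 2 =
      ∫ z in Ioc a b, f z ^ 2 := by
    intro f
    rw [← Real.sqrt_eq_rpow, Real.sq_sqrt (integral_nonneg fun z => by positivity)]
    simp
  rw [h4, h4]

theorem intervalIntegrable_mul_of_sq {a b : ℝ} (hab : a ≤ b) {k h : ℝ → ℝ}
    (hk : IntervalIntegrable (fun z => k z ^ 2) volume a b)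
    (hh : IntervalIntegrable (fun z => h z ^ 2) volume a b)
    (hk' : AEStronglyMeasurable k (volume.restrict (Ioc a b)))
    (hh' : AEStronglyMeasurable h (volume.restrict (Ioc a b))) :
    IntervalIntegrable (fun z => k z * h z) volume a b := by
  rw [intervalIntegrable_iff_integrableOn_Ioc_of_le hab] at hk hh ⊢
  exact ((memLp_two_iff_integrable_sq hk').2 hk).integrable_mul
    ((memLp_two_iff_integrable_sq hh').2 hh)

/-- Cauchy-Schwarz in the Taylor remainder, once its kernel is dominated by `(z - x)^{1 - μ/2}`.
Expanding at the right end is essential: it gives `x ≤ z`, so every power of `x` can be replaced by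
one of `z` and the weights cancel, uniformly down to `0`. -/
theorem norm_sub_kernelPart_sq_le {α β μ : ℝ} (hα : 0 ≤ α) (hμ : 0 ≤ μ) (hμ3 : μ < 3)
    (hμβ : μ ≤ 2 * β) (u : 𝓓(halfLine, ℂ)) {x b : ℝ} (hx : 0 < x) (hxb : x ≤ b) :
    ‖u x - kernelPart α β u b x‖ ^ 2 * x ^ (-μ) ≤
      (b - x) ^ (3 - μ) / (3 - μ) * ∫ z in x..b, ‖diffOp α β u z‖ ^ 2 := by
  have hrem : u x - kernelPart α β u b x = (x ^ β : ℝ) •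
      ∫ z in x..b, (rpowPrim α z - rpowPrim α x) • testDeriv (quotDeriv α β u) z := by
    rw [eq_rpow_smul_quotFn β u hx, kernelPart, ← smul_sub, quotFn_expansion hα u hx hxb]
    congr 1
    abel
  have hxμ : x ^ (-μ) = (x ^ (-μ / 2)) ^ 2 := by
    rw [← Real.rpow_natCast, ← Real.rpow_mul hx.le]; norm_num
  set k : ℝ → ℝ := fun z => (z - x) ^ (1 - μ / 2) with hk
  set h : ℝ → ℝ := fun z => ‖diffOp α β u z‖ with hh
  have hhc : Continuous h := (diffOp α β u).continuous.norm
  have hk2 : ∀ z ∈ Ioc x b, k z ^ 2 = (z - x) ^ (2 - μ) := by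
    intro z hz
    rw [hk, ← Real.rpow_natCast, ← Real.rpow_mul (by linarith [hz.1])]
    norm_num
    ring_nf
  have hkint0 : IntervalIntegrable (fun z => (z - x) ^ (2 - μ)) volume x b := by
    have := (intervalIntegral.intervalIntegrable_rpow' (a := 0) (b := b - x)
      (by linarith : -1 < 2 - μ)).comp_sub_right x
    simpa using this
  have hkint : IntervalIntegrable (fun z => k z ^ 2) volume x b := by
    refine hkint0.congr ?_
    rw [uIoc_of_le hxb]
    exact fun z hz => (hk2 z hz).symm
  have hkval : ∫ z in x..b, k z ^ 2 = (b - x) ^ (3 - μ) / (3 - μ) := by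
    rw [intervalIntegral.integral_congr_ae (g := fun z => (z - x) ^ (2 - μ))
      (Eventually.of_forall fun z hz => hk2 z (by rwa [uIoc_of_le hxb] at hz))]
    rw [intervalIntegral.integral_comp_sub_right (fun z => z ^ (2 - μ)), sub_self,
      integral_rpow (Or.inl (by linarith)), show 2 - μ + 1 = 3 - μ by ring,
      Real.zero_rpow (by linarith), sub_zero]
  have hkm : Measurable k := by fun_prop
  have hcs := integral_mul_sq_le hxb hkint ((hhc.pow 2).intervalIntegrable _ _)
    hkm.aestronglyMeasurable hhc.aestronglyMeasurable
  rw [hkval] at hcs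
  refine le_trans ?_ hcs
  rw [hxμ, ← mul_pow]
  refine pow_le_pow_left₀ (by positivity) ?_ 2
  rw [hrem, norm_smul, Real.norm_of_nonneg (by positivity), mul_right_comm, ← Real.rpow_add hx,
    ← Real.norm_of_nonneg (by positivity : 0 ≤ x ^ (β + -μ / 2)), ← norm_smul,
    ← intervalIntegral.integral_smul]
  refine intervalIntegral.norm_integral_le_of_norm_le hxb (Eventually.of_forall fun z hz => ?_)
    (intervalIntegrable_mul_of_sq hxb hkint ((hhc.pow 2).intervalIntegrable _ _)
      hkm.aestronglyMeasurable hhc.aestronglyMeasurable)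
  have hz0 : 0 < z := hx.trans hz.1
  have hzx : 0 < z - x := sub_pos.2 hz.1
  have hs0 : 0 ≤ rpowPrim α z - rpowPrim α x :=
    le_trans (by positivity) (le_rpowPrim_sub hα hx.le hz.1.le)
  rw [testDeriv_quotDeriv α β u hz0, norm_smul, norm_smul, norm_smul,
    Real.norm_of_nonneg (by positivity), Real.norm_of_nonneg hs0,
    Real.norm_of_nonneg (by positivity), ← mul_assoc, ← mul_assoc]
  refine mul_le_mul_of_nonneg_right ?_ (norm_nonneg _)
  -- The exponent `β - μ/2` is nonnegative because `μ ≤ 2β`, so the first factor increases with its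
  -- base. After cancellation, `z ≥ z - x` and the negative power finish the bound.
  calc x ^ (β + -μ / 2) * (rpowPrim α z - rpowPrim α x) * z ^ (-(α + β))
      ≤ z ^ (β + -μ / 2) * (z ^ α * (z - x)) * z ^ (-(α + β)) := by
        have h1 : x ^ (β + -μ / 2) ≤ z ^ (β + -μ / 2) :=
          Real.rpow_le_rpow hx.le hz.1.le (by linarith)
        have h2 := rpowPrim_sub_le hα hx.le hz.1.le
        gcongr
    _ = z ^ (-μ / 2) * (z - x) := by
        have e : z ^ (-μ / 2) = z ^ (β + -μ / 2) * z ^ α * z ^ (-(α + β)) := by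
          rw [← Real.rpow_add hz0, ← Real.rpow_add hz0]
          congr 1
          ring
        rw [e]
        ring
    _ ≤ (z - x) ^ (-μ / 2) * (z - x) := by
        have h1 : z ^ (-μ / 2) ≤ (z - x) ^ (-μ / 2) :=
          Real.rpow_le_rpow_of_nonpos hzx (by linarith) (by linarith)
        gcongr
    _ = k z := by
        rw [hk, ← Real.rpow_add_one hzx.ne']
        congr 1
        ring

theorem exists_norm_sq_mul_le (u : 𝓓(halfLine, ℂ)) {c d : ℝ} (hcd : c ≤ d) :
    ∃ y ∈ Icc c d, ‖u y‖ ^ 2 * (d - c) ≤ ∫ z in c..d, ‖u z‖ ^ 2 := by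
  have hc : Continuous fun z => ‖u z‖ ^ 2 := u.continuous.norm.pow 2
  obtain ⟨y, hy, hmin⟩ := isCompact_Icc.exists_isMinOn (nonempty_Icc.2 hcd) hc.continuousOn
  refine ⟨y, hy, ?_⟩
  have h := intervalIntegral.integral_mono_on (μ := volume) (f := fun _ => ‖u y‖ ^ 2) hcd
    intervalIntegrable_const (hc.intervalIntegrable c d) fun t ht => hmin ht
  rw [intervalIntegral.integral_const, smul_eq_mul] at h
  linarith

theorem integral_sub_interval_le {f : ℝ → ℝ} (hf : Continuous f) (hf0 : ∀ x, 0 ≤ f x)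
    {a b c d : ℝ} (hac : a ≤ c) (hcd : c ≤ d) (hdb : d ≤ b) :
    ∫ z in c..d, f z ≤ ∫ z in a..b, f z :=
  intervalIntegral.integral_mono_interval hac hcd hdb (Eventually.of_forall hf0)
    (hf.intervalIntegrable (μ := volume) a b)

/-- Divided by `x^β`, a kernel element is affine in `rpowPrim α`, so two well separated values
determine it. Taking both points in the right half of the interval makes them at least `b/2`, where
the weights are comparable to those at `b`. -/
theorem norm_kernelPart_le {α β μ : ℝ} (hα : 0 ≤ α) (hβ : 0 ≤ β) (hμ : 0 ≤ μ) (hμβ : μ ≤ 2 * β)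
    (u : 𝓓(halfLine, ℂ)) {a b x y₁ y₂ : ℝ} (ha : 0 ≤ a) (hx : 0 < x) (hax : a ≤ x) (hxb : x ≤ b)
    (hab : a < b) (hy₁ : b - (b - a) / 2 ≤ y₁) (hy : y₁ + (b - a) / 4 ≤ y₂) (hy₂ : y₂ ≤ b) :
    ‖kernelPart α β u b x‖ * x ^ (-μ / 2) ≤ 4 * 2 ^ α * 2 ^ β * (b - a) ^ (-μ / 2) *
      (‖kernelPart α β u b y₁‖ + ‖kernelPart α β u b y₂‖) := by
  have hb : 0 < b := ha.trans_lt hab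
  have hl : 0 < b - a := sub_pos.2 hab
  have hy₁b : b / 2 ≤ y₁ := by linarith
  have hy₁0 : 0 < y₁ := by linarith
  have hy₂0 : 0 < y₂ := by linarith
  set κ : ℝ → ℂ := fun x => quotFn β u b - (rpowPrim α b - rpowPrim α x) • quotDeriv α β u b with hκ
  have hK : ∀ y, 0 < y → ‖kernelPart α β u b y‖ = y ^ β * ‖κ y‖ := fun y hy => by
    rw [kernelPart, norm_smul, Real.norm_of_nonneg (by positivity)]
  have hmono : ∀ s t : ℝ, 0 ≤ s → s ≤ t → rpowPrim α s ≤ rpowPrim α t := fun s t hs hst => by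
    have : 0 ≤ s ^ α * (t - s) := mul_nonneg (by positivity) (by linarith)
    linarith [le_rpowPrim_sub hα hs hst]
  -- Linear interpolation. The ratio of `rpowPrim α b - rpowPrim α a` to the gap between the nodes
  -- is at most `4 * 2^α`.
  have hinterp : (rpowPrim α y₂ - rpowPrim α y₁) • κ x =
      (rpowPrim α y₂ - rpowPrim α x) • κ y₁ + (rpowPrim α x - rpowPrim α y₁) • κ y₂ := by
    simp only [hκ, Complex.real_smul]
    push_cast
    ring
  have hgap : (b / 2) ^ α * ((b - a) / 4) ≤ rpowPrim α y₂ - rpowPrim α y₁ := by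
    refine le_trans ?_ (le_rpowPrim_sub hα hy₁0.le (by linarith))
    have h1 : (b / 2) ^ α ≤ y₁ ^ α := Real.rpow_le_rpow (by positivity) hy₁b hα
    have h2 : (b - a) / 4 ≤ y₂ - y₁ := by linarith
    gcongr
  have hspan : rpowPrim α b - rpowPrim α a ≤ b ^ α * (b - a) := rpowPrim_sub_le hα ha hab.le
  have m1 := hmono a x ha hax
  have m2 := hmono x b hx.le hxb
  have m3 := hmono a y₁ ha (by linarith)
  have m4 := hmono y₁ y₂ hy₁0.le (by linarith)
  have m5 := hmono y₂ b hy₂0.le hy₂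
  have hκx : ‖κ x‖ ≤ 4 * 2 ^ α * (‖κ y₁‖ + ‖κ y₂‖) := by
    have h1 := congrArg norm hinterp
    rw [norm_smul, Real.norm_of_nonneg (by linarith)] at h1
    have h2 : ‖(rpowPrim α y₂ - rpowPrim α x) • κ y₁ + (rpowPrim α x - rpowPrim α y₁) • κ y₂‖ ≤
        b ^ α * (b - a) * ‖κ y₁‖ + b ^ α * (b - a) * ‖κ y₂‖ := by
      refine (norm_add_le _ _).trans ?_
      rw [norm_smul, norm_smul]
      refine add_le_add (mul_le_mul_of_nonneg_right ?_ (norm_nonneg _))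
        (mul_le_mul_of_nonneg_right ?_ (norm_nonneg _)) <;>
      · rw [Real.norm_eq_abs, abs_le]
        constructor <;> linarith
    have h3 : (b / 2) ^ α * ((b - a) / 4) * ‖κ x‖ ≤ b ^ α * (b - a) * (‖κ y₁‖ + ‖κ y₂‖) := by
      refine (mul_le_mul_of_nonneg_right hgap (norm_nonneg _)).trans ?_
      rw [h1]
      linarith
    have h4 : b ^ α = 2 ^ α * (b / 2) ^ α := by
      rw [← Real.mul_rpow (by norm_num) (by positivity)]
      congr 1
      ring
    rw [h4] at h3
    have h5 : 0 < (b / 2) ^ α * ((b - a) / 4) := by positivity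
    refine le_of_mul_le_mul_left (h3.trans (le_of_eq ?_)) h5
    ring
  have hκy : ∀ y, b / 2 ≤ y → ‖κ y‖ ≤ (b / 2) ^ (-β) * ‖kernelPart α β u b y‖ := by
    intro y hy
    have hy0 : 0 < y := by linarith
    rw [hK y hy0, ← mul_assoc]
    refine le_mul_of_one_le_left (norm_nonneg _) ?_
    rw [Real.rpow_neg (by positivity), inv_mul_eq_div, one_le_div (by positivity)]
    exact Real.rpow_le_rpow (by positivity) hy hβ
  calc ‖kernelPart α β u b x‖ * x ^ (-μ / 2) = x ^ (β + -μ / 2) * ‖κ x‖ := by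
        rw [hK x hx, Real.rpow_add hx]; ring
    _ ≤ b ^ (β + -μ / 2) * (4 * 2 ^ α * ((b / 2) ^ (-β) * ‖kernelPart α β u b y₁‖ +
          (b / 2) ^ (-β) * ‖kernelPart α β u b y₂‖)) := by
        have h1 : x ^ (β + -μ / 2) ≤ b ^ (β + -μ / 2) :=
          Real.rpow_le_rpow hx.le hxb (by linarith)
        have h2 := hκy y₁ hy₁b
        have h3 := hκy y₂ (by linarith)
        have h4 : ‖κ x‖ ≤ 4 * 2 ^ α * ((b / 2) ^ (-β) * ‖kernelPart α β u b y₁‖ +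
          (b / 2) ^ (-β) * ‖kernelPart α β u b y₂‖) := hκx.trans (by gcongr)
        gcongr
    _ = 4 * 2 ^ α * 2 ^ β * b ^ (-μ / 2) *
          (‖kernelPart α β u b y₁‖ + ‖kernelPart α β u b y₂‖) := by
        have e : b ^ (β + -μ / 2) * (b / 2) ^ (-β) = 2 ^ β * b ^ (-μ / 2) := by
          rw [Real.div_rpow hb.le (by norm_num), Real.rpow_neg (by norm_num : (0 : ℝ) ≤ 2),
            div_inv_eq_mul, ← mul_assoc, ← Real.rpow_add hb, mul_comm]
          congr 2
          ring
        linear_combination (4 * 2 ^ α *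
          (‖kernelPart α β u b y₁‖ + ‖kernelPart α β u b y₂‖)) * e
    _ ≤ _ := by
        have h1 : b ^ (-μ / 2) ≤ (b - a) ^ (-μ / 2) :=
          Real.rpow_le_rpow_of_nonpos hl (by linarith) (by linarith)
        gcongr

theorem norm_sub_kernelPart_sq_le' {α β μ : ℝ} (hα : 0 ≤ α) (hμ : 0 ≤ μ) (hμ3 : μ < 3)
    (hμβ : μ ≤ 2 * β) (u : 𝓓(halfLine, ℂ)) {a b x : ℝ} (hx : 0 < x) (hax : a ≤ x) (hxb : x ≤ b) :
    ‖u x - kernelPart α β u b x‖ ^ 2 * x ^ (-μ) ≤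
      (b - a) ^ (3 - μ) / (3 - μ) * ∫ z in a..b, ‖diffOp α β u z‖ ^ 2 := by
  refine (norm_sub_kernelPart_sq_le hα hμ hμ3 hμβ u hx hxb).trans ?_
  have h1 : (b - x) ^ (3 - μ) ≤ (b - a) ^ (3 - μ) :=
    Real.rpow_le_rpow (by linarith) (by linarith) (by linarith)
  have h2 := integral_sub_interval_le (f := fun z => ‖diffOp α β u z‖ ^ 2)
    ((diffOp α β u).continuous.norm.pow 2) (fun z => by positivity) hax hxb le_rfl
  have h3 : 0 < 3 - μ := by linarith
  have h4 : 0 ≤ ∫ z in x..b, ‖diffOp α β u z‖ ^ 2 :=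
    intervalIntegral.integral_nonneg hxb fun z _ => by positivity
  have h6 : 0 ≤ (b - a) ^ (3 - μ) := Real.rpow_nonneg (by linarith) _
  exact mul_le_mul (div_le_div_of_nonneg_right h1 h3.le) h2 h4 (by positivity)

/-- At a point where `|u|²` is controlled by its mean, the kernel element differs from `u` by the
remainder with `μ = 0`. The factor `16` is `2 * 8`, and `2/3` is rounded up to `1`. -/
theorem norm_kernelPart_sq_le {α β : ℝ} (hα : 0 ≤ α) (hβ : 0 ≤ β) (u : 𝓓(halfLine, ℂ))
    {a b y P : ℝ} (ha : 0 ≤ a) (hab : a < b) (hy : b - (b - a) / 2 ≤ y) (hyb : y ≤ b)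
    (hyP : ‖u y‖ ^ 2 * ((b - a) / 8) ≤ P) :
    ‖kernelPart α β u b y‖ ^ 2 ≤
      16 * ((b - a)⁻¹ * P) + (b - a) ^ 3 * ∫ z in a..b, ‖diffOp α β u z‖ ^ 2 := by
  have hl : 0 < b - a := sub_pos.2 hab
  have h1 := norm_sub_kernelPart_sq_le' (β := β) hα le_rfl (by norm_num) (by linarith) u
    (by linarith : 0 < y) (by linarith : a ≤ y) hyb
  rw [neg_zero, Real.rpow_zero, mul_one, sub_zero] at h1
  have h1' : (b - a) ^ (3 : ℝ) = (b - a) ^ 3 := by norm_cast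
  rw [h1'] at h1
  have h2 : ‖u y‖ ^ 2 ≤ 8 * ((b - a)⁻¹ * P) := by
    have h5 : 8 * ((b - a)⁻¹ * P) = P / ((b - a) / 8) := by field_simp
    rw [h5, le_div_iff₀ (by positivity)]
    exact hyP
  have h3 : ‖kernelPart α β u b y‖ ≤ ‖u y‖ + ‖u y - kernelPart α β u b y‖ := by
    have := norm_sub_le (u y) (u y - kernelPart α β u b y)
    rwa [sub_sub_cancel] at this
  have h4 : ‖kernelPart α β u b y‖ ^ 2 ≤ 2 * ‖u y‖ ^ 2 +
      2 * ‖u y - kernelPart α β u b y‖ ^ 2 := by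
    refine (pow_le_pow_left₀ (norm_nonneg _) h3 2).trans ?_
    nlinarith [sq_nonneg (‖u y‖ - ‖u y - kernelPart α β u b y‖)]
  have h6 : 0 ≤ (b - a) ^ 3 * ∫ z in a..b, ‖diffOp α β u z‖ ^ 2 :=
    mul_nonneg (by positivity) (intervalIntegral.integral_nonneg hab.le fun z _ => by positivity)
  linarith

/-- The constant in the weighted Sobolev inequality on intervals. -/
def sobolevConst (α β μ : ℝ) : ℝ := 2 / (3 - μ) + 128 * (4 * 2 ^ α * 2 ^ β) ^ 2

theorem rpow_neg_half_sq (μ : ℝ) {t : ℝ} (ht : 0 < t) : (t ^ (-μ / 2)) ^ 2 = t ^ (-μ) := by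
  rw [← Real.rpow_natCast, ← Real.rpow_mul ht.le]; norm_num

theorem norm_kernelPart_sq_mul_rpow_le {α β μ : ℝ} (hα : 0 ≤ α) (hβ : 0 ≤ β) (hμ : 0 ≤ μ)
    (hμβ : μ ≤ 2 * β) (u : 𝓓(halfLine, ℂ)) {a b x : ℝ} (ha : 0 ≤ a) (hx : 0 < x) (hax : a ≤ x)
    (hxb : x ≤ b) (hab : a < b) :
    ‖kernelPart α β u b x‖ ^ 2 * x ^ (-μ) ≤ (4 * 2 ^ α * 2 ^ β) ^ 2 * (b - a) ^ (-μ) *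
      (64 * ((b - a)⁻¹ * ∫ z in a..b, ‖u z‖ ^ 2) +
        4 * ((b - a) ^ 3 * ∫ z in a..b, ‖diffOp α β u z‖ ^ 2)) := by
  have hl : 0 < b - a := sub_pos.2 hab
  have hcP : Continuous fun z => ‖u z‖ ^ 2 := u.continuous.norm.pow 2
  -- The nodes lie in two intervals of length `(b - a)/8` in the right half, at distance at least
  -- `(b - a)/4` from each other.
  obtain ⟨y₁, hy₁, hu₁⟩ := exists_norm_sq_mul_le u
    (by linarith : b - (b - a) / 2 ≤ b - 3 * (b - a) / 8)
  obtain ⟨y₂, hy₂, hu₂⟩ := exists_norm_sq_mul_le u (by linarith : b - (b - a) / 8 ≤ b)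
  have hP₁ := hu₁.trans (integral_sub_interval_le hcP (fun z => by positivity)
    (by linarith : a ≤ b - (b - a) / 2) (by linarith) (by linarith : b - 3 * (b - a) / 8 ≤ b))
  have hP₂ := hu₂.trans (integral_sub_interval_le hcP (fun z => by positivity)
    (by linarith : a ≤ b - (b - a) / 8) (by linarith) le_rfl)
  rw [show b - 3 * (b - a) / 8 - (b - (b - a) / 2) = (b - a) / 8 by ring] at hP₁
  rw [show b - (b - (b - a) / 8) = (b - a) / 8 by ring] at hP₂
  have hK₁ := norm_kernelPart_sq_le hα hβ u ha hab hy₁.1 (by linarith [hy₁.2]) hP₁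
  have hK₂ := norm_kernelPart_sq_le hα hβ u ha hab (by linarith [hy₂.1]) hy₂.2 hP₂
  have hKx := norm_kernelPart_le hα hβ hμ hμβ u ha hx hax hxb hab hy₁.1
    (by linarith [hy₁.2, hy₂.1]) hy₂.2
  have h1 := pow_le_pow_left₀ (by positivity) hKx 2
  rw [mul_pow, rpow_neg_half_sq μ hx, mul_pow, mul_pow _ ((b - a) ^ (-μ / 2)),
    rpow_neg_half_sq μ hl] at h1
  refine h1.trans (mul_le_mul_of_nonneg_left ?_ (by positivity))
  linarith [add_sq_le (a := ‖kernelPart α β u b y₁‖) (b := ‖kernelPart α β u b y₂‖)]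

/-- Remainder plus kernel element. Relative to `l^{3-μ}`, the factor `l^{-μ} l^{-1}` produced by the
kernel element becomes the scale `l^{-4}` that bounds the eigenvalues in the end. -/
theorem norm_sq_mul_rpow_le {α β μ : ℝ} (hα : 0 ≤ α) (hβ : 0 ≤ β) (hμ : 0 ≤ μ) (hμ3 : μ < 3)
    (hμβ : μ ≤ 2 * β) (u : 𝓓(halfLine, ℂ)) {a b x : ℝ} (ha : 0 ≤ a) (hx : 0 < x) (hax : a ≤ x)
    (hxb : x ≤ b) (hab : a < b) :
    ‖u x‖ ^ 2 * x ^ (-μ) ≤ sobolevConst α β μ * (b - a) ^ (3 - μ) *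
      ((∫ z in a..b, ‖diffOp α β u z‖ ^ 2) + (b - a) ^ (-4 : ℝ) * ∫ z in a..b, ‖u z‖ ^ 2) := by
  have hl : 0 < b - a := sub_pos.2 hab
  have hK := norm_kernelPart_sq_mul_rpow_le hα hβ hμ hμβ u ha hx hax hxb hab
  have hr := norm_sub_kernelPart_sq_le' hα hμ hμ3 hμβ u hx hax hxb
  have hN0 : 0 ≤ ∫ z in a..b, ‖diffOp α β u z‖ ^ 2 :=
    intervalIntegral.integral_nonneg hab.le fun z _ => by positivity
  have hP0 : 0 ≤ ∫ z in a..b, ‖u z‖ ^ 2 :=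
    intervalIntegral.integral_nonneg hab.le fun z _ => by positivity
  generalize (∫ z in a..b, ‖diffOp α β u z‖ ^ 2) = N at *
  generalize (∫ z in a..b, ‖u z‖ ^ 2) = P at *
  have hux : ‖u x‖ ^ 2 ≤ 2 * (‖u x - kernelPart α β u b x‖ ^ 2 + ‖kernelPart α β u b x‖ ^ 2) := by
    have h3 : ‖u x‖ ≤ ‖u x - kernelPart α β u b x‖ + ‖kernelPart α β u b x‖ := by
      have := norm_add_le (u x - kernelPart α β u b x) (kernelPart α β u b x)
      rwa [sub_add_cancel] at this
    exact (pow_le_pow_left₀ (norm_nonneg _) h3 2).trans add_sq_le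
  have hx' : 0 ≤ x ^ (-μ) := by positivity
  have hux' := mul_le_mul_of_nonneg_right hux hx'
  have e1 : (b - a) ^ (-μ) * (b - a) ^ 3 = (b - a) ^ (3 - μ) := by
    rw [← Real.rpow_natCast, ← Real.rpow_add hl]; congr 1; push_cast; ring
  have e2 : (b - a) ^ (-μ) * (b - a)⁻¹ = (b - a) ^ (3 - μ) * (b - a) ^ (-4 : ℝ) := by
    rw [← Real.rpow_neg_one, ← Real.rpow_add hl, ← Real.rpow_add hl]; congr 1; ring
  have h3μ : 0 < 3 - μ := by linarith
  have hΛ0 : 0 ≤ (b - a) ^ (3 - μ) := by positivity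
  have h40 : 0 ≤ (b - a) ^ (-4 : ℝ) := by positivity
  rw [sobolevConst]
  generalize ‖u x - kernelPart α β u b x‖ = r at *
  generalize ‖kernelPart α β u b x‖ = k at *
  generalize ‖u x‖ = v at *
  generalize (4 : ℝ) * 2 ^ α * 2 ^ β = ρ at *
  generalize (b - a) ^ (3 - μ) = Λ at *
  generalize (b - a) ^ (-4 : ℝ) = T at *
  generalize (b - a) ^ (-μ) = m at *
  generalize x ^ (-μ) = X at *
  generalize (b - a)⁻¹ = i at *
  have hr' : r ^ 2 * X ≤ 1 / (3 - μ) * Λ * N := hr.trans (le_of_eq (by ring))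
  have hK' : k ^ 2 * X ≤ 64 * (ρ ^ 2 * Λ * (T * P)) + 4 * (ρ ^ 2 * Λ * N) := by
    refine hK.trans (le_of_eq ?_)
    linear_combination (64 * ρ ^ 2 * P) * e2 + (4 * ρ ^ 2 * N) * e1
  have p1 : 0 ≤ ρ ^ 2 * Λ * N := by positivity
  have p2 : 0 ≤ 1 / (3 - μ) * Λ * (T * P) := by positivity
  have e3 : (2 / (3 - μ) + 128 * ρ ^ 2) * Λ * (N + T * P) =
      2 * (1 / (3 - μ) * Λ * N) + 2 * (1 / (3 - μ) * Λ * (T * P)) + 128 * (ρ ^ 2 * Λ * N) +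
        128 * (ρ ^ 2 * Λ * (T * P)) := by ring
  rw [e3]
  linarith

theorem norm_sq_mul_rpow_le_of_cauchyData {α β μ : ℝ} (hα : 0 ≤ α) (hμ : 0 ≤ μ) (hμ3 : μ < 3)
    (hμβ : μ ≤ 2 * β) (u : 𝓓(halfLine, ℂ)) {a b x : ℝ} (hx : 0 < x) (hax : a ≤ x)
    (hxb : x ≤ b) (h0 : quotFn β u b = 0) (h1 : quotDeriv α β u b = 0) :
    ‖u x‖ ^ 2 * x ^ (-μ) ≤ sobolevConst α β μ * (b - a) ^ (3 - μ) *
      ∫ z in a..b, ‖diffOp α β u z‖ ^ 2 := by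
  have h := norm_sub_kernelPart_sq_le' hα hμ hμ3 hμβ u hx hax hxb
  have hk : kernelPart α β u b x = 0 := by simp [kernelPart, h0, h1]
  rw [hk, sub_zero] at h
  refine h.trans ?_
  have h3μ : 0 < 3 - μ := by linarith
  have h5 : 1 / (3 - μ) ≤ sobolevConst α β μ := by
    have : 1 / (3 - μ) ≤ 2 / (3 - μ) := by gcongr; norm_num
    rw [sobolevConst]
    nlinarith [sq_nonneg ((4 : ℝ) * 2 ^ α * 2 ^ β)]
  have h6 : 0 ≤ (b - a) ^ (3 - μ) := Real.rpow_nonneg (by linarith) _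
  have h7 : 0 ≤ ∫ z in a..b, ‖diffOp α β u z‖ ^ 2 :=
    intervalIntegral.integral_nonneg (hax.trans hxb) fun z _ => by positivity
  rw [div_eq_mul_one_div, mul_comm (_ ^ _)]
  gcongr

end IntervalEstimates

/-! ### Partition of the half-line by length and mass -/

section Partition

theorem exists_partition_step {Φ : ℝ → ℝ} (hΦ : Continuous Φ) {a θ κ η : ℝ} (hθ : 0 < θ)
    (hκ : 0 < κ) (hη : 0 < η) (hΦη : ∀ l, 1 ≤ l → η ≤ Φ (a + l) - Φ a) :
    ∃ l, 0 < l ∧ l ^ θ * (Φ (a + l) - Φ a) = κ := by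
  obtain ⟨T, hT, hT1⟩ := ((tendsto_rpow_atTop hθ).eventually_ge_atTop (κ / η) |>.and
    (eventually_ge_atTop 1)).exists
  have hc : Continuous fun l : ℝ => l ^ θ * (Φ (a + l) - Φ a) :=
    (Real.continuous_rpow_const hθ.le).mul
      ((hΦ.comp (continuous_const.add continuous_id)).sub continuous_const)
  have hmem : κ ∈ Icc ((0 : ℝ) ^ θ * (Φ (a + 0) - Φ a)) (T ^ θ * (Φ (a + T) - Φ a)) := by
    refine ⟨by simp [hκ.le], ?_⟩
    rw [div_le_iff₀ hη] at hT
    exact hT.trans (mul_le_mul_of_nonneg_left (hΦη T hT1) (by positivity))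
  obtain ⟨l, hl, hlκ⟩ := intermediate_value_Icc (by linarith : (0 : ℝ) ≤ T) hc.continuousOn hmem
  refine ⟨l, lt_of_le_of_ne hl.1 ?_, hlκ⟩
  rintro rfl
  simp at hlκ
  exact hκ.ne hlκ

/-- A partition of `(0, ∞)` into intervals of length `l` and mass at most `κ l^{-θ}`, with control
of the sum of `l^{-θ}`. -/
theorem exists_partition {J : ℝ → ℝ} (hJ : Integrable J) (hJ0 : 0 ≤ᵐ[volume] J) {θ κ δ : ℝ}
    (hθ : 0 < θ) (hκ : 0 < κ) (hδ : 0 < δ) :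
    ∃ t : ℕ → ℝ, t 0 = 0 ∧ (∀ k, t k < t (k + 1)) ∧ Tendsto t atTop atTop ∧
      (∀ k, (t (k + 1) - t k) ^ θ * (∫ x in t k..t (k + 1), J x) ≤ κ) ∧
      (∃ c, 0 < c ∧ ∀ k, c ≤ t (k + 1) - t k) ∧
      ∀ n, ∑ k ∈ Finset.range n, ((t (k + 1) - t k) ^ θ)⁻¹ ≤ ((∫ x, J x) + δ) / κ := by
  -- A strictly increasing function on the half-line with total increase `δ`. Added to the mass, it
  -- makes each step finite even where `J` vanishes, and it changes the total by at most `δ`.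
  let S : ℝ → ℝ := fun x => δ * (1 - (1 + max x 0)⁻¹)
  let Φ : ℝ → ℝ := fun x => (∫ y in (0 : ℝ)..x, J y) + S x
  have hII : ∀ a b, IntervalIntegrable J volume a b := fun a b => hJ.intervalIntegrable
  have hmax : ∀ x : ℝ, 0 < 1 + max x 0 := fun x => by positivity
  have hS : Continuous S := by
    refine continuous_const.mul (continuous_const.sub (Continuous.inv₀ ?_ fun x => (hmax x).ne'))
    fun_prop
  have hΦ : Continuous Φ := (intervalIntegral.continuous_primitive hII 0).add hS
  have hsub : ∀ a b, Φ b - Φ a = (∫ y in a..b, J y) + (S b - S a) := fun a b => by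
    simp only [Φ]
    rw [← intervalIntegral.integral_interval_sub_left (hII 0 b) (hII 0 a)]
    ring
  have hJint : ∀ a b, a ≤ b → 0 ≤ ∫ y in a..b, J y := fun a b hab =>
    intervalIntegral.integral_nonneg_of_ae hab hJ0
  have hSmono : ∀ a b, a ≤ b → S a ≤ S b := fun a b hab => by
    have h1 : (1 + max b 0)⁻¹ ≤ (1 + max a 0)⁻¹ :=
      inv_anti₀ (hmax a) (by have := max_le_max_right 0 hab; linarith)
    exact mul_le_mul_of_nonneg_left (by linarith) hδ.le
  have hstep : ∀ a : ℝ, ∃ l, 0 < l ∧ (0 ≤ a → l ^ θ * (Φ (a + l) - Φ a) = κ) := by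
    intro a
    rcases lt_or_ge a 0 with ha | ha
    -- A default step length; the partition points are never negative.
    · exact ⟨1, one_pos, fun h => absurd h (not_le.2 ha)⟩
    · have hη : 0 < S (a + 1) - S a := by
        have h1 : (1 + max (a + 1) 0)⁻¹ < (1 + max a 0)⁻¹ := by
          rw [max_eq_left ha, max_eq_left (by linarith)]
          exact inv_strictAnti₀ (by linarith) (by linarith)
        have := mul_lt_mul_of_pos_left h1 hδ
        simp only [S]
        linarith
      obtain ⟨l, hl, hl'⟩ := exists_partition_step hΦ (a := a) hθ hκ hη fun l hl => by
        rw [hsub]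
        have h1 := hJint a (a + l) (by linarith)
        have h2 := hSmono (a + 1) (a + l) (by linarith)
        linarith
      exact ⟨l, hl, fun _ => hl'⟩
  choose l hl0 hl using hstep
  let t : ℕ → ℝ := fun n => (fun a => a + l a)^[n] 0
  have ht : ∀ k, t (k + 1) = t k + l (t k) := fun k => Function.iterate_succ_apply' _ _ _
  have hlt : ∀ k, t k < t (k + 1) := fun k => by rw [ht]; linarith [hl0 (t k)]
  have ht0 : ∀ k, 0 ≤ t k := by
    intro k
    induction k with
    | zero => exact le_rfl
    | succ k ih => exact ih.trans (hlt k).le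
  have hkey : ∀ k, (t (k + 1) - t k) ^ θ * (Φ (t (k + 1)) - Φ (t k)) = κ := fun k => by
    have := hl (t k) (ht0 k)
    rw [← ht] at this
    rwa [ht, add_sub_cancel_left, ← ht]
  have hlpos : ∀ k, 0 < t (k + 1) - t k := fun k => sub_pos.2 (hlt k)
  have hΦ0 : ∀ x, 0 ≤ x → Φ x - Φ 0 ≤ (∫ y, J y) + δ := fun x hx => by
    rw [hsub, intervalIntegral.integral_of_le hx]
    have h1 : ∫ y in Ioc 0 x, J y ≤ ∫ y, J y := setIntegral_le_integral hJ hJ0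
    have h2 : S x ≤ δ := by
      have : 0 < (1 + max x 0)⁻¹ := inv_pos.2 (hmax x)
      simp only [S]
      nlinarith
    have h3 : S 0 = 0 := by simp [S]
    linarith
  have hmono : ∀ a b, a ≤ b → Φ a ≤ Φ b := fun a b hab => by
    have := hsub a b
    have := hJint a b hab
    have := hSmono a b hab
    linarith
  have hI : 0 < (∫ y, J y) + δ := by
    have : 0 ≤ ∫ y, J y := integral_nonneg_of_ae hJ0
    linarith
  -- The increase of `Φ` over a step never exceeds its bounded total, so the equation for the step
  -- forces a uniform lower bound on the length; hence the points tend to infinity.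
  have hc : ∀ k, (κ / ((∫ y, J y) + δ)) ^ (1 / θ) ≤ t (k + 1) - t k := by
    intro k
    have h1 : Φ (t (k + 1)) - Φ (t k) ≤ (∫ y, J y) + δ := by
      have := hΦ0 _ (ht0 (k + 1))
      have := hmono 0 (t k) (ht0 k)
      linarith
    have h2 : κ / ((∫ y, J y) + δ) ≤ (t (k + 1) - t k) ^ θ := by
      rw [div_le_iff₀ hI, ← hkey k]
      exact mul_le_mul_of_nonneg_left h1 (Real.rpow_nonneg (hlpos k).le _)
    have h3 := Real.rpow_le_rpow (by positivity) h2 (by positivity : 0 ≤ 1 / θ)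
    rwa [← Real.rpow_mul (hlpos k).le, mul_one_div_cancel hθ.ne', Real.rpow_one] at h3
  have hc0 : 0 < (κ / ((∫ y, J y) + δ)) ^ (1 / θ) := by positivity
  refine ⟨t, rfl, hlt, ?_, fun k => ?_, ⟨_, hc0, hc⟩, fun n => ?_⟩
  · have hge : ∀ n : ℕ, n * (κ / ((∫ y, J y) + δ)) ^ (1 / θ) ≤ t n := by
      intro n
      induction n with
      | zero => simp [t]
      | succ n ih =>
        have := hc n
        push_cast
        linarith
    exact tendsto_atTop_mono hge (tendsto_natCast_atTop_atTop.atTop_mul_const hc0)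
  · rw [← hkey k, hsub]
    refine mul_le_mul_of_nonneg_left ?_ (Real.rpow_nonneg (hlpos k).le _)
    linarith [hSmono _ _ (hlt k).le]
  -- The steps were chosen to give equality, so the sum of `l^{-θ}` telescopes.
  · have h1 : ∀ k, ((t (k + 1) - t k) ^ θ)⁻¹ = (Φ (t (k + 1)) - Φ (t k)) / κ := by
      intro k
      have := Real.rpow_pos_of_pos (hlpos k) θ
      rw [← hkey k]
      have hne : Φ (t (k + 1)) - Φ (t k) ≠ 0 := fun h0 => by
        have := hkey k
        rw [h0, mul_zero] at this
        exact hκ.ne this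
      field_simp
    simp_rw [h1]
    rw [← Finset.sum_div, Finset.sum_range_sub (fun k => Φ (t k))]
    exact div_le_div_of_nonneg_right (hΦ0 _ (ht0 n)) hκ.le

end Partition

/-! ### The potential on one interval -/

section Potential

variable {V : ℝ → ℝ} {p ν : ℝ}

/-- Split according to `y ≤ τ` or `y > τ`. This pointwise bound, with `τ` optimised by scaling,
takes the place of Hölder's inequality and covers `p = 1` as well. -/
theorem le_add_rpow_mul {p y τ : ℝ} (hp : 1 ≤ p) (hy : 0 ≤ y) (hτ : 0 < τ) :
    y ≤ τ + τ ^ (1 - p) * y ^ p := by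
  rcases le_or_gt y τ with h | h
  · have : 0 ≤ τ ^ (1 - p) * y ^ p := by positivity
    linarith
  · have hy0 : 0 < y := hτ.trans h
    have h1 : y ^ (1 - p) ≤ τ ^ (1 - p) := Real.rpow_le_rpow_of_nonpos hτ h.le (by linarith)
    have h2 : y = y ^ (1 - p) * y ^ p := by
      rw [← Real.rpow_add hy0]; simp
    have h3 : y ^ (1 - p) * y ^ p ≤ τ ^ (1 - p) * y ^ p := by gcongr
    linarith

theorem weight_rpow_eq {p ν v x : ℝ} (hp : 1 ≤ p) (hv : 0 ≤ v) (hx : 0 < x) :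
    (v * x ^ (ν / p)) ^ p = v ^ p * x ^ ν := by
  rw [Real.mul_rpow hv (by positivity), ← Real.rpow_mul hx.le, div_mul_cancel₀ _ (by linarith)]

theorem weight_le (hp : 1 ≤ p) (hV : ∀ᵐ x ∂(volume.restrict (Ioi (0 : ℝ))), 0 ≤ V x) {τ : ℝ}
    (hτ : 0 < τ) : ∀ᵐ x ∂(volume.restrict (Ioi (0 : ℝ))),
      0 ≤ V x * x ^ (ν / p) ∧ V x * x ^ (ν / p) ≤ τ + τ ^ (1 - p) * (V x ^ p * x ^ ν) := by
  filter_upwards [hV, ae_restrict_mem measurableSet_Ioi] with x hx hx0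
  have hx0' : 0 < x := hx0
  have h0 : 0 ≤ V x * x ^ (ν / p) := by positivity
  refine ⟨h0, ?_⟩
  rw [← weight_rpow_eq hp hx hx0']
  exact le_add_rpow_mul hp h0 hτ

/-- Measurability of `V` is not assumed; it is recovered from the integrable function `V^p x^ν` by
undoing the weight and the power. -/
theorem aemeasurable_potential (hp : 1 ≤ p)
    (hV : ∀ᵐ x ∂(volume.restrict (Ioi (0 : ℝ))), 0 ≤ V x)
    (hVi : IntegrableOn (fun x => V x ^ p * x ^ ν) (Ioi 0)) :
    AEMeasurable V (volume.restrict (Ioi (0 : ℝ))) := by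
  have h1 : AEMeasurable (fun x => (V x ^ p * x ^ ν * x ^ (-ν)) ^ (1 / p))
      (volume.restrict (Ioi (0 : ℝ))) :=
    (hVi.aemeasurable.mul (by fun_prop)).pow_const _
  refine h1.congr ?_
  filter_upwards [hV, ae_restrict_mem measurableSet_Ioi] with x hx hx0
  have hx0' : 0 < x := hx0
  rw [mul_assoc, ← Real.rpow_add hx0', add_neg_cancel, Real.rpow_zero, mul_one,
    ← Real.rpow_mul hx, mul_one_div_cancel (by linarith), Real.rpow_one]

/-- The weight `x^{ν/p}` is moved from the test function to `V`, and `V x^{ν/p} ≤ 1 + V^p x^ν`. -/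
theorem integrable_potential_mul (hp : 1 ≤ p)
    (hV : ∀ᵐ x ∂(volume.restrict (Ioi (0 : ℝ))), 0 ≤ V x)
    (hVi : IntegrableOn (fun x => V x ^ p * x ^ ν) (Ioi 0)) (u : 𝓓(halfLine, ℂ)) :
    IntegrableOn (fun x => V x * ‖u x‖ ^ 2) (Ioi 0) := by
  let φ : ℝ → ℝ := fun x => ‖mulRpow (-(ν / p) / 2) u x‖ ^ 2
  have hφc : Continuous φ := (mulRpow (-(ν / p) / 2) u).continuous.norm.pow 2
  have hφs : HasCompactSupport φ :=
    (mulRpow (-(ν / p) / 2) u).hasCompactSupport.comp_left (g := fun z : ℂ => ‖z‖ ^ 2) (by simp)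
  obtain ⟨B, hB⟩ := hφc.bounded_above_of_compact_support hφs
  have hdom : IntegrableOn (fun x => φ x + (V x ^ p * x ^ ν) * φ x) (Ioi 0) :=
    (hφc.integrable_of_hasCompactSupport hφs).integrableOn.add
      (Integrable.mul_bdd hVi hφc.aestronglyMeasurable (Eventually.of_forall hB))
  refine Integrable.mono hdom ((aemeasurable_potential hp hV hVi).mul
    (u.continuous.norm.pow 2).aemeasurable).aestronglyMeasurable ?_
  filter_upwards [hV, weight_le (ν := ν) hp hV one_pos, ae_restrict_mem measurableSet_Ioi] with x hx
    hw hx0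
  have hx0' : 0 < x := hx0
  have hφx : V x * ‖u x‖ ^ 2 = V x * x ^ (ν / p) * φ x := by
    simp only [φ, mulRpow_apply, norm_smul, mul_pow]
    rw [Real.norm_of_nonneg (by positivity), rpow_neg_half_sq _ hx0', Real.rpow_neg hx0'.le]
    field_simp
  have hφ0 : 0 ≤ φ x := by positivity
  rw [hφx, Real.norm_of_nonneg (mul_nonneg hw.1 hφ0), Real.norm_of_nonneg
    (add_nonneg hφ0 (mul_nonneg (by positivity) hφ0))]
  have h2 := mul_le_mul_of_nonneg_right hw.2 hφ0
  rw [Real.one_rpow] at h2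
  linarith

theorem rpow_mul_integral_weight_le {γ : ℝ} (hp : 1 ≤ p) (hγp : p = γ + (1 + ν) / 4)
    (hV : ∀ᵐ x ∂(volume.restrict (Ioi (0 : ℝ))), 0 ≤ V x)
    (hVi : IntegrableOn (fun x => V x ^ p * x ^ ν) (Ioi 0)) {a b ε : ℝ} (ha : 0 ≤ a)
    (hab : a < b) (hε : 0 < ε)
    (hm : (b - a) ^ (4 * γ) * (∫ x in Ioc a b, V x ^ p * x ^ ν) ≤ ε ^ p) :
    IntegrableOn (fun x => V x * x ^ (ν / p)) (Ioc a b) ∧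
      (b - a) ^ (3 - ν / p) * (∫ x in Ioc a b, V x * x ^ (ν / p)) ≤ 2 * ε := by
  have hl : 0 < b - a := sub_pos.2 hab
  have hsub : Ioc a b ⊆ Ioi 0 := fun x hx => lt_of_le_of_lt ha hx.1
  have hle : volume.restrict (Ioc a b) ≤ volume.restrict (Ioi 0) := Measure.restrict_mono_set _ hsub
  have hdom : ∀ τ : ℝ, IntegrableOn (fun x => τ + τ ^ (1 - p) * (V x ^ p * x ^ ν)) (Ioc a b) :=
    fun τ => (integrableOn_const (by simp)).add ((hVi.mono_set hsub).const_mul _)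
  have hint : IntegrableOn (fun x => V x * x ^ (ν / p)) (Ioc a b) := by
    have hmeas : Measurable fun x : ℝ => x ^ (ν / p) := by fun_prop
    refine Integrable.mono (hdom 1) ((((aemeasurable_potential hp hV hVi).mul
      hmeas.aemeasurable).mono_measure hle).aestronglyMeasurable) ?_
    filter_upwards [ae_mono hle (weight_le (ν := ν) hp hV one_pos)] with x hx
    rw [Real.norm_of_nonneg hx.1]
    exact hx.2.trans (le_abs_self _)
  refine ⟨hint, ?_⟩
  set μ := ν / p with hμ
  have hμp : μ * p = ν := by rw [hμ, div_mul_cancel₀ _ (by linarith)]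
  -- This choice makes the constant part contribute exactly `ε`; in the other part the powers of `b
  -- - a` then add up to `4γ`, by the relation between `p`, `γ` and `ν`.
  set τ := ε * (b - a) ^ (μ - 4) with hτ
  have hτ0 : 0 < τ := by positivity
  have h1 : ∫ x in Ioc a b, V x * x ^ μ ≤
      ∫ x in Ioc a b, (τ + τ ^ (1 - p) * (V x ^ p * x ^ ν)) := by
    refine integral_mono_ae hint (hdom τ) ?_
    filter_upwards [ae_mono hle (weight_le (ν := ν) hp hV hτ0)] with x hx
    exact hx.2
  have hconst : Integrable (fun _ : ℝ => τ) (volume.restrict (Ioc a b)) :=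
    integrableOn_const (by simp)
  rw [integral_add hconst ((hVi.mono_set hsub).const_mul _),
    integral_const_mul (τ ^ (1 - p)), setIntegral_const, Real.volume_real_Ioc_of_le hab.le, smul_eq_mul] at h1
  set I := ∫ x in Ioc a b, V x ^ p * x ^ ν with hI
  have e1 : (b - a) ^ (3 - μ) * ((b - a) * τ) = ε := by
    have h2 : (b - a) ^ (3 - μ) * (b - a) * (b - a) ^ (μ - 4) = 1 := by
      rw [← Real.rpow_add_one hl.ne', ← Real.rpow_add hl]
      ring_nf
      simp
    rw [hτ]
    linear_combination ε * h2
  have e2 : (b - a) ^ (3 - μ) * τ ^ (1 - p) = ε ^ (1 - p) * (b - a) ^ (4 * γ) := by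
    rw [hτ, Real.mul_rpow hε.le (by positivity), ← Real.rpow_mul hl.le, mul_left_comm,
      ← Real.rpow_add hl]
    congr 2
    have : (μ - 4) * (1 - p) = μ - ν - 4 + 4 * p := by rw [← hμp]; ring
    rw [this, hγp]
    ring
  have e3 : ε ^ (1 - p) * ε ^ p = ε := by rw [← Real.rpow_add hε]; simp
  calc (b - a) ^ (3 - μ) * ∫ x in Ioc a b, V x * x ^ μ
      ≤ (b - a) ^ (3 - μ) * ((b - a) * τ + τ ^ (1 - p) * I) := by gcongr
    _ = ε + ε ^ (1 - p) * ((b - a) ^ (4 * γ) * I) := by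
        linear_combination e1 + I * e2
    _ ≤ ε + ε ^ (1 - p) * ε ^ p := by gcongr
    _ = 2 * ε := by rw [e3]; ring

theorem setIntegral_potential_le {γ : ℝ} (hp : 1 ≤ p) (hγp : p = γ + (1 + ν) / 4)
    (hV : ∀ᵐ x ∂(volume.restrict (Ioi (0 : ℝ))), 0 ≤ V x)
    (hVi : IntegrableOn (fun x => V x ^ p * x ^ ν) (Ioi 0)) (u : 𝓓(halfLine, ℂ))
    {a b ε K Z : ℝ} (ha : 0 ≤ a) (hab : a < b) (hε : 0 < ε)
    (hm : (b - a) ^ (4 * γ) * (∫ x in Ioc a b, V x ^ p * x ^ ν) ≤ ε ^ p)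
    (hK : 4 * ε * K = 1) (hK0 : 0 ≤ K) (hZ : 0 ≤ Z)
    (hu : ∀ x ∈ Ioc a b, ‖u x‖ ^ 2 * x ^ (-(ν / p)) ≤ K * (b - a) ^ (3 - ν / p) * Z) :
    ∫ x in Ioc a b, V x * ‖u x‖ ^ 2 ≤ 1 / 2 * Z := by
  have hsub : Ioc a b ⊆ Ioi 0 := fun x hx => lt_of_le_of_lt ha hx.1
  have hle : volume.restrict (Ioc a b) ≤ volume.restrict (Ioi 0) := Measure.restrict_mono_set _ hsub
  obtain ⟨hint, hbd⟩ := rpow_mul_integral_weight_le hp hγp hV hVi ha hab hε hm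
  have h1 : ∫ x in Ioc a b, V x * ‖u x‖ ^ 2 ≤
      ∫ x in Ioc a b, V x * x ^ (ν / p) * (K * (b - a) ^ (3 - ν / p) * Z) := by
    refine integral_mono_ae ((integrable_potential_mul hp hV hVi u).mono_set hsub)
      (hint.mul_const _) ?_
    filter_upwards [ae_mono hle (weight_le (ν := ν) hp hV one_pos),
      ae_restrict_mem measurableSet_Ioc] with x hx hxI
    have hx0 : 0 < x := hsub hxI
    have h2 : V x * ‖u x‖ ^ 2 = V x * x ^ (ν / p) * (‖u x‖ ^ 2 * x ^ (-(ν / p))) := by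
      rw [Real.rpow_neg hx0.le]
      field_simp
    rw [h2]
    exact mul_le_mul_of_nonneg_left (hu x hxI) hx.1
  rw [integral_mul_const] at h1
  calc ∫ x in Ioc a b, V x * ‖u x‖ ^ 2
      ≤ K * Z * ((b - a) ^ (3 - ν / p) * ∫ x in Ioc a b, V x * x ^ (ν / p)) :=
        h1.trans (le_of_eq (by ring))
    _ ≤ K * Z * (2 * ε) := by gcongr
    -- The normalisation `4 ε K = 1` was made for this factor `1/2`, the relative form bound.
    _ = 1 / 2 * Z := by linear_combination (Z / 2) * hK

end Potential

/-! ### Completion of the form domain -/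

section GraphSpace

variable {H : Type*} [NormedAddCommGroup H] [InnerProductSpace ℂ H]
variable {D : Type*} [AddCommGroup D] [Module ℂ D]

/-- The map `u ↦ (j u, L u, r u)` into the Hilbert space `H³`. -/
def tripleMap (j L r : D →ₗ[ℂ] H) : D →ₗ[ℂ] PiLp 2 (fun _ : Fin 3 => H) :=
  (WithLp.linearEquiv 2 ℂ (Fin 3 → H)).symm.toLinearMap ∘ₗ LinearMap.pi ![j, L, r]

/-- The completion of `D` in the norm `‖j u‖² + ‖L u‖² + ‖r u‖²`. -/
def graphSpace (j L r : D →ₗ[ℂ] H) : Submodule ℂ (PiLp 2 (fun _ : Fin 3 => H)) :=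
  (LinearMap.range (tripleMap j L r)).topologicalClosure

instance instCompleteSpaceGraphSpace [CompleteSpace H] (j L r : D →ₗ[ℂ] H) :
    CompleteSpace (graphSpace j L r) :=
  (Submodule.isClosed_topologicalClosure _).completeSpace_coe

/-- The embedding of `D` into its completion. -/
def toGraphSpace (j L r : D →ₗ[ℂ] H) : D →ₗ[ℂ] graphSpace j L r :=
  (tripleMap j L r).codRestrict _ fun u => Submodule.le_topologicalClosure _ ⟨u, rfl⟩

/-- The coordinates of the completion. -/
def graphProj (j L r : D →ₗ[ℂ] H) (k : Fin 3) : graphSpace j L r →L[ℂ] H :=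
  (PiLp.proj 2 (fun _ : Fin 3 => H) k).comp (graphSpace j L r).subtypeL

theorem norm_sq_graphSpace (j L r : D →ₗ[ℂ] H) (x : graphSpace j L r) :
    ‖x‖ ^ 2 = ‖graphProj j L r 0 x‖ ^ 2 + ‖graphProj j L r 1 x‖ ^ 2 +
      ‖graphProj j L r 2 x‖ ^ 2 := by
  have h := PiLp.norm_sq_eq_of_L2 (fun _ : Fin 3 => H) (x : PiLp 2 (fun _ : Fin 3 => H))
  rw [Fin.sum_univ_three] at h
  exact h

theorem denseRange_toGraphSpace (j L r : D →ₗ[ℂ] H) : DenseRange (toGraphSpace j L r) := by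
  intro x
  rw [closure_subtype]
  have hx : (x : PiLp 2 (fun _ : Fin 3 => H)) ∈ closure (LinearMap.range (tripleMap j L r) : Set _) :=
    x.2
  refine closure_mono ?_ hx
  rintro _ ⟨u, rfl⟩
  exact ⟨toGraphSpace j L r u, ⟨u, rfl⟩, rfl⟩

/-- Keeping `r u` as a third coordinate makes all three maps bounded at once. The first coordinate
is injective: if it vanishes, so does the second by closability of `L`, and then the third by the
relative bound. -/
theorem formModel_graphSpace {j L r : D →ₗ[ℂ] H} {q : D → ℝ} {C : ℝ} (hC : 0 ≤ C)
    (hj : DenseRange j) (hq : ∀ u, q u = ‖L u‖ ^ 2 - ‖r u‖ ^ 2)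
    (hbound : ∀ u, ‖r u‖ ^ 2 ≤ 1 / 2 * ‖L u‖ ^ 2 + C * ‖j u‖ ^ 2)
    (hclos : ∀ (s : ℕ → D) (h : H), Tendsto (fun n => j (s n)) atTop (𝓝 0) →
      Tendsto (fun n => L (s n)) atTop (𝓝 h) → h = 0) :
    FormModel j q (toGraphSpace j L r) (graphProj j L r 0) (graphProj j L r 1)
      (graphProj j L r 2) C := by
  have hb : ∀ x, ‖graphProj j L r 2 x‖ ^ 2 ≤
      1 / 2 * ‖graphProj j L r 1 x‖ ^ 2 + C * ‖graphProj j L r 0 x‖ ^ 2 := by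
    intro x
    refine (denseRange_toGraphSpace j L r).induction_on x (isClosed_le (by fun_prop) (by fun_prop))
      fun u => ?_
    exact hbound u
  refine ⟨hC, denseRange_toGraphSpace j L r, fun u => rfl, fun u => hq u, ?_, ?_, hb, fun x => ?_⟩
  · refine (injective_iff_map_eq_zero _).2 fun x hx => ?_
    obtain ⟨y, hy, hlim⟩ := mem_closure_iff_seq_limit.1 (denseRange_toGraphSpace j L r x)
    choose s hs using hy
    have hlim' : Tendsto (fun n => toGraphSpace j L r (s n)) atTop (𝓝 x) := by
      simpa only [hs] using hlim
    have h0 := ((graphProj j L r 0).continuous.tendsto x).comp hlim'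
    rw [hx] at h0
    have h1 := hclos s _ h0 (((graphProj j L r 1).continuous.tendsto x).comp hlim')
    have h2 := hb x
    rw [h1, hx] at h2
    have h3 := norm_sq_graphSpace j L r x
    rw [h1, hx] at h3
    simp only [norm_zero] at h2 h3
    have h4 : ‖x‖ ^ 2 = 0 := le_antisymm (by rw [h3]; linarith) (by positivity)
    exact norm_eq_zero.1 (pow_eq_zero_iff two_ne_zero |>.1 h4)
  · exact hj.mono (by rintro _ ⟨u, rfl⟩; exact ⟨toGraphSpace j L r u, rfl⟩)
  · rw [norm_sq_graphSpace]
    have h1 := hb x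
    nlinarith [sq_nonneg ‖graphProj j L r 0 x‖,
      mul_nonneg hC (sq_nonneg ‖graphProj j L r 1 x‖), sq_nonneg ‖graphProj j L r 1 x‖]

end GraphSpace

/-! ### The form as a difference of squares, and summation over the partition -/

section PotentialMap

variable {V : ℝ → ℝ} {p ν : ℝ}

theorem memLp_sqrt_potential_smul (hp : 1 ≤ p)
    (hV : ∀ᵐ x ∂(volume.restrict (Ioi (0 : ℝ))), 0 ≤ V x)
    (hVi : IntegrableOn (fun x => V x ^ p * x ^ ν) (Ioi 0)) (u : 𝓓(halfLine, ℂ)) :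
    MemLp (fun x => Real.sqrt (V x) • u x) 2 (volume.restrict (Ioi (0 : ℝ))) := by
  have hm : AEStronglyMeasurable (fun x => Real.sqrt (V x) • u x)
      (volume.restrict (Ioi (0 : ℝ))) :=
    (Real.continuous_sqrt.measurable.comp_aemeasurable
      (aemeasurable_potential hp hV hVi)).aestronglyMeasurable.smul
      u.continuous.aestronglyMeasurable
  rw [memLp_two_iff_integrable_sq_norm hm]
  refine (integrable_potential_mul hp hV hVi u).congr ?_
  filter_upwards [hV] with x hx
  rw [norm_smul, mul_pow, Real.norm_of_nonneg (Real.sqrt_nonneg _), Real.sq_sqrt hx]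

/-- The map `u ↦ V^{1/2} u` from `C₀^∞(0, ∞)` to `L²(0, ∞)`. -/
def sqrtPotentialMap (hp : 1 ≤ p) (hV : ∀ᵐ x ∂(volume.restrict (Ioi (0 : ℝ))), 0 ≤ V x)
    (hVi : IntegrableOn (fun x => V x ^ p * x ^ ν) (Ioi 0)) : 𝓓(halfLine, ℂ) →ₗ[ℂ] L2HalfLine where
  toFun u := (memLp_sqrt_potential_smul hp hV hVi u).toLp
  map_add' u v := by
    rw [← MemLp.toLp_add]
    refine MemLp.toLp_congr _ _ (Eventually.of_forall fun x => ?_)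
    exact smul_add (Real.sqrt (V x)) (u x) (v x)
  map_smul' c u := by
    rw [RingHom.id_apply, ← MemLp.toLp_const_smul]
    refine MemLp.toLp_congr _ _ (Eventually.of_forall fun x => ?_)
    exact smul_comm (Real.sqrt (V x)) c (u x)

theorem norm_sqrtPotentialMap_sq (hp : 1 ≤ p)
    (hV : ∀ᵐ x ∂(volume.restrict (Ioi (0 : ℝ))), 0 ≤ V x)
    (hVi : IntegrableOn (fun x => V x ^ p * x ^ ν) (Ioi 0)) (u : 𝓓(halfLine, ℂ)) :
    ‖sqrtPotentialMap hp hV hVi u‖ ^ 2 = ∫ x in Ioi (0 : ℝ), V x * ‖u x‖ ^ 2 := by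
  have h : inner ℂ (sqrtPotentialMap hp hV hVi u) (sqrtPotentialMap hp hV hVi u) =
      ((∫ x in Ioi (0 : ℝ), V x * ‖u x‖ ^ 2 : ℝ) : ℂ) := by
    rw [L2.inner_def, ← integral_complex_ofReal]
    refine integral_congr_ae ?_
    filter_upwards [hV, (memLp_sqrt_potential_smul hp hV hVi u).coeFn_toLp] with x hx hx2
    have hx3 : sqrtPotentialMap hp hV hVi u x = Real.sqrt (V x) • u x := hx2
    rw [hx3, inner_self_eq_ofReal, norm_smul, mul_pow, Real.norm_of_nonneg (Real.sqrt_nonneg _),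
      Real.sq_sqrt hx]
  rw [inner_self_eq_ofReal] at h
  exact_mod_cast h

theorem halfLineForm_eq (α β : ℝ) (hp : 1 ≤ p)
    (hV : ∀ᵐ x ∂(volume.restrict (Ioi (0 : ℝ))), 0 ≤ V x)
    (hVi : IntegrableOn (fun x => V x ^ p * x ^ ν) (Ioi 0)) (u : 𝓓(halfLine, ℂ)) :
    halfLineForm α β V u =
      ‖testToL2 (diffOp α β u)‖ ^ 2 - ‖sqrtPotentialMap hp hV hVi u‖ ^ 2 := by
  rw [norm_testToL2_sq, norm_sqrtPotentialMap_sq, halfLineForm, ← integral_sub _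
    (integrable_potential_mul hp hV hVi u)]
  · refine setIntegral_congr_fun measurableSet_Ioi fun x hx => ?_
    rw [norm_diffOp_sq α β u hx]
  · exact ((testFunction_memLp (diffOp α β u)).integrable_norm_pow two_ne_zero)

/-- `∫₀^∞` as a sum over the intervals of a partition. -/
theorem integral_eq_sum_partition {f : ℝ → ℝ} (hf : IntegrableOn f (Ioi 0)) {t : ℕ → ℝ}
    (ht0 : t 0 = 0) (ht : ∀ k, t k < t (k + 1)) {n : ℕ} (hn : ∀ x, t n < x → f x = 0) :
    ∫ x in Ioi (0 : ℝ), f x = ∑ k ∈ Finset.range n, ∫ x in Ioc (t k) (t (k + 1)), f x := by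
  have hmono : Monotone t := monotone_nat_of_le_succ fun k => (ht k).le
  have hpos : ∀ k, 0 ≤ t k := fun k => ht0 ▸ hmono (Nat.zero_le k)
  have h1 : ∫ x in Ioi (0 : ℝ), f x = ∫ x in Ioc 0 (t n), f x := by
    refine setIntegral_eq_of_subset_of_forall_sdiff_eq_zero measurableSet_Ioi
      (fun x hx => hx.1) fun x hx => hn x ?_
    by_contra! hle
    exact hx.2 ⟨hx.1, hle⟩
  rw [h1, ← intervalIntegral.integral_of_le (hpos n), ← ht0,
    ← intervalIntegral.sum_integral_adjacent_intervals fun k _ => ?_]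
  · exact Finset.sum_congr rfl fun k _ => intervalIntegral.integral_of_le (ht k).le
  · rw [intervalIntegrable_iff_integrableOn_Ioc_of_le (ht k).le]
    exact hf.mono_set fun x hx => lt_of_le_of_lt (hpos k) hx.1

theorem exists_forall_gt_eq_zero (u : 𝓓(halfLine, ℂ)) : ∃ T : ℝ, ∀ x, T < x → u x = 0 := by
  obtain ⟨T, hT⟩ := u.hasCompactSupport.isCompact.bddAbove
  exact ⟨T, fun x hx => image_eq_zero_of_notMem_tsupport fun h => absurd (hT h) (not_le.2 hx)⟩

/-- Summation of interval estimates. -/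
theorem norm_sqrtPotentialMap_sq_le (α β : ℝ) (hp : 1 ≤ p)
    (hV : ∀ᵐ x ∂(volume.restrict (Ioi (0 : ℝ))), 0 ≤ V x)
    (hVi : IntegrableOn (fun x => V x ^ p * x ^ ν) (Ioi 0)) {t : ℕ → ℝ}
    (ht0 : t 0 = 0) (ht : ∀ k, t k < t (k + 1)) (htop : Tendsto t atTop atTop)
    (u : 𝓓(halfLine, ℂ)) {c E : ℝ}
    (h : ∀ k, ∫ x in Ioc (t k) (t (k + 1)), V x * ‖u x‖ ^ 2 ≤
      c * (∫ x in Ioc (t k) (t (k + 1)), ‖diffOp α β u x‖ ^ 2) +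
        E * ∫ x in Ioc (t k) (t (k + 1)), ‖u x‖ ^ 2) :
    ‖sqrtPotentialMap hp hV hVi u‖ ^ 2 ≤
      c * ‖testToL2 (diffOp α β u)‖ ^ 2 + E * ‖testToL2 u‖ ^ 2 := by
  obtain ⟨T₁, hT₁⟩ := exists_forall_gt_eq_zero u
  obtain ⟨T₂, hT₂⟩ := exists_forall_gt_eq_zero (diffOp α β u)
  -- Supports are bounded, so finitely many intervals suffice and no infinite sum arises.
  obtain ⟨n, hn⟩ := (htop.eventually_ge_atTop (max T₁ T₂)).exists
  have hn₁ : ∀ x, t n < x → u x = 0 := fun x hx => hT₁ x ((le_max_left _ _).trans_lt (hn.trans_lt hx))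
  have hn₂ : ∀ x, t n < x → diffOp α β u x = 0 := fun x hx =>
    hT₂ x ((le_max_right _ _).trans_lt (hn.trans_lt hx))
  rw [norm_sqrtPotentialMap_sq, norm_testToL2_sq, norm_testToL2_sq,
    integral_eq_sum_partition (integrable_potential_mul hp hV hVi u) ht0 ht
      (fun x hx => by rw [hn₁ x hx]; simp),
    integral_eq_sum_partition ((testFunction_memLp (diffOp α β u)).integrable_norm_pow two_ne_zero)
      ht0 ht (fun x hx => by rw [hn₂ x hx]; simp),
    integral_eq_sum_partition ((testFunction_memLp u).integrable_norm_pow two_ne_zero)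
      ht0 ht (fun x hx => by rw [hn₁ x hx]; simp), Finset.mul_sum, Finset.mul_sum,
    ← Finset.sum_add_distrib]
  exact Finset.sum_le_sum fun k _ => h k

end PotentialMap

/-! ### The adapted partition and the final bound -/

section Main

variable {V : ℝ → ℝ} {p ν : ℝ}

theorem sobolevConst_pos (α β : ℝ) {μ : ℝ} (hμ3 : μ < 3) : 0 < sobolevConst α β μ := by
  have : 0 < 3 - μ := by linarith
  unfold sobolevConst
  positivity

/-- A partition of `(0, ∞)` adapted to `V`: on each interval the potential is bounded relative to
the unperturbed form, without a lower order term for functions with vanishing Cauchy data at the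
right end point. -/
theorem exists_adapted_partition {α β γ : ℝ} (hα : 0 ≤ α) (hβ : 0 ≤ β) (hν : 0 ≤ ν) (hγ : 0 < γ)
    (hp : 1 ≤ p) (hγp : p = γ + (1 + ν) / 4) (hμ3 : ν / p < 3) (hμβ : ν / p ≤ 2 * β)
    (hV : ∀ᵐ x ∂(volume.restrict (Ioi (0 : ℝ))), 0 ≤ V x)
    (hVi : IntegrableOn (fun x => V x ^ p * x ^ ν) (Ioi 0)) {δ : ℝ} (hδ : 0 < δ) :
    ∃ t : ℕ → ℝ, t 0 = 0 ∧ (∀ k, t k < t (k + 1)) ∧ Tendsto t atTop atTop ∧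
      (∀ (k : ℕ) (u : 𝓓(halfLine, ℂ)), ∫ x in Ioc (t k) (t (k + 1)), V x * ‖u x‖ ^ 2 ≤
        1 / 2 * ((∫ x in Ioc (t k) (t (k + 1)), ‖diffOp α β u x‖ ^ 2) +
          (t (k + 1) - t k) ^ (-4 : ℝ) * ∫ x in Ioc (t k) (t (k + 1)), ‖u x‖ ^ 2)) ∧
      (∀ (k : ℕ) (u : 𝓓(halfLine, ℂ)), quotFn β u (t (k + 1)) = 0 →
        quotDeriv α β u (t (k + 1)) = 0 → ∫ x in Ioc (t k) (t (k + 1)), V x * ‖u x‖ ^ 2 ≤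
        1 / 2 * ∫ x in Ioc (t k) (t (k + 1)), ‖diffOp α β u x‖ ^ 2) ∧
      (∃ c, 0 < c ∧ ∀ k, c ≤ t (k + 1) - t k) ∧
      ∀ n, ∑ k ∈ Finset.range n, ((t (k + 1) - t k) ^ (-4 : ℝ)) ^ γ ≤
        ((∫ x in Ioi (0 : ℝ), V x ^ p * x ^ ν) + δ) /
          (1 / (4 * sobolevConst α β (ν / p))) ^ p := by
  set K := sobolevConst α β (ν / p) with hK
  have hK0 : 0 < K := sobolevConst_pos α β hμ3
  have hμ : 0 ≤ ν / p := by positivity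
  set ε := 1 / (4 * K) with hε
  have hε0 : 0 < ε := by positivity
  have hεK : 4 * ε * K = 1 := by rw [hε]; field_simp
  have hJ : Integrable ((Ioi (0 : ℝ)).indicator fun x => V x ^ p * x ^ ν) :=
    (integrable_indicator_iff measurableSet_Ioi).2 hVi
  have hJ0 : 0 ≤ᵐ[volume] (Ioi (0 : ℝ)).indicator fun x => V x ^ p * x ^ ν := by
    rw [ae_restrict_iff' measurableSet_Ioi] at hV
    filter_upwards [hV] with x hx
    refine indicator_apply_nonneg fun hx0 => ?_
    have h1 : 0 < x := hx0
    have h2 := hx hx0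
    positivity
  obtain ⟨t, ht0, ht, htop, hmass, hc, hsum⟩ := exists_partition hJ hJ0
    (by positivity : 0 < 4 * γ) (by positivity : 0 < ε ^ p) hδ
  have hmono : Monotone t := monotone_nat_of_le_succ fun k => (ht k).le
  have hpos : ∀ k, 0 ≤ t k := fun k => ht0 ▸ hmono (Nat.zero_le k)
  have hm : ∀ k, (t (k + 1) - t k) ^ (4 * γ) *
      (∫ x in Ioc (t k) (t (k + 1)), V x ^ p * x ^ ν) ≤ ε ^ p := by
    intro k
    have h1 := hmass k
    rw [intervalIntegral.integral_of_le (ht k).le] at h1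
    rwa [setIntegral_congr_fun measurableSet_Ioc fun x hx =>
      indicator_of_mem (show x ∈ Ioi (0 : ℝ) from (hpos k).trans_lt hx.1) _] at h1
  refine ⟨t, ht0, ht, htop, fun k u => ?_, fun k u h0 h1 => ?_, hc, fun n => ?_⟩
  · have hl : 0 < t (k + 1) - t k := sub_pos.2 (ht k)
    refine setIntegral_potential_le hp hγp hV hVi u (hpos k) (ht k) hε0 (hm k) hεK hK0.le
      (by positivity) fun x hx => ?_
    have := norm_sq_mul_rpow_le hα hβ hμ hμ3 hμβ u (hpos k) ((hpos k).trans_lt hx.1) hx.1.le hx.2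
      (ht k)
    rwa [intervalIntegral.integral_of_le (ht k).le, intervalIntegral.integral_of_le (ht k).le]
      at this
  · refine setIntegral_potential_le hp hγp hV hVi u (hpos k) (ht k) hε0 (hm k) hεK hK0.le
      (by positivity) fun x hx => ?_
    have := norm_sq_mul_rpow_le_of_cauchyData hα hμ hμ3 hμβ u ((hpos k).trans_lt hx.1) hx.1.le
      hx.2 h0 h1
    rwa [intervalIntegral.integral_of_le (ht k).le] at this
  · rw [integral_indicator measurableSet_Ioi] at hsum
    refine le_trans (le_of_eq (Finset.sum_congr rfl fun k _ => ?_)) (hsum n)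
    have hl : 0 ≤ t (k + 1) - t k := (sub_pos.2 (ht k)).le
    rw [← Real.rpow_mul hl, ← Real.rpow_neg hl]
    congr 1
    ring

/-- The Cauchy data of a function at `b`. -/
def cauchyData (α β b : ℝ) : 𝓓(halfLine, ℂ) →ₗ[ℂ] (Fin 2 → ℂ) where
  toFun u := ![quotFn β u b, quotDeriv α β u b]
  map_add' u v := by
    ext i
    fin_cases i <;> simp
  map_smul' c u := by
    ext i
    fin_cases i <;> simp

theorem finite_setOf_lt_of_sum_rpow_le {a : ℕ → ℝ} (ha : ∀ k, 0 ≤ a k) {γ B : ℝ} (hγ : 0 < γ)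
    (h : ∀ n, ∑ k ∈ Finset.range n, a k ^ γ ≤ B) {E : ℝ} (hE : 0 < E) : {k | E < a k}.Finite := by
  have hs : Summable fun k => a k ^ γ :=
    summable_of_sum_range_le (fun k => Real.rpow_nonneg (ha k) _) h
  have h1 := hs.tendsto_cofinite_zero.eventually (gt_mem_nhds (Real.rpow_pos_of_pos hE γ))
  rw [eventually_cofinite] at h1
  refine h1.subset fun k hk => not_lt.2 ?_
  exact (Real.rpow_lt_rpow hE.le hk hγ).le

end Main

end

theorem theorem3 (α β ν γ : ℝ) (hα : 0 ≤ α) (hβ : 0 ≤ β) (hν : 0 ≤ ν) (hν3 : ν < 3)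
    (hνβ : ν ≤ 2 * β) (hγ : (3 - ν) / 4 ≤ γ) :
    ∃ C : ℝ, 0 < C ∧ ∀ V : ℝ → ℝ,
      (∀ᵐ x ∂(volume.restrict (Ioi (0 : ℝ))), 0 ≤ V x) →
      IntegrableOn (fun x => V x ^ (γ + (1 + ν) / 4) * x ^ ν) (Ioi 0) →
      FormSemibounded testToL2 (halfLineForm α β V) ∧
      FormClosable testToL2 (halfLineForm α β V) ∧
      ∃ (Q : Submodule ℂ L2HalfLine) (b : Q →ₗ⋆[ℂ] Q →ₗ[ℂ] ℂ)
        (A : L2HalfLine →ₗ.[ℂ] L2HalfLine),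
        IsFormClosure testToL2 (halfLineForm α β V) Q b ∧
        IsFormOperator Q b A ∧
        IsSelfAdjoint A ∧
        DiscreteNegativeSpectrum A ∧
        traceNegPow A γ ≤
          ENNReal.ofReal (C * ∫ x in Ioi (0 : ℝ), V x ^ (γ + (1 + ν) / 4) * x ^ ν) := by
  have hγ0 : 0 < γ := by linarith
  obtain ⟨p, hγp⟩ : ∃ p, p = γ + (1 + ν) / 4 := ⟨_, rfl⟩
  rw [← hγp]
  have hp : 1 ≤ p := by linarith
  have hμν : ν / p ≤ ν := div_le_self hν hp
  have hμ3 : ν / p < 3 := hμν.trans_lt hν3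
  have hμβ : ν / p ≤ 2 * β := hμν.trans hνβ
  have hK := sobolevConst_pos α β hμ3
  obtain ⟨κ, hκ⟩ : ∃ κ, κ = (1 / (4 * sobolevConst α β (ν / p))) ^ p := ⟨_, rfl⟩
  have hκ0 : 0 < κ := by rw [hκ]; positivity
  -- The factor `2` counts the Cauchy data per interval; `κ` is the admissible mass and depends only
  -- on `α`, `β`, `ν` and `p`.
  refine ⟨2 / κ, by positivity, fun V hV hVi => ?_⟩
  have hpart := fun (δ : ℝ) (hδ : 0 < δ) =>
    exists_adapted_partition hα hβ hν hγ0 hp hγp hμ3 hμβ hV hVi hδ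
  rw [← hκ] at hpart
  -- One fixed partition supplies the relative form bound and so the operator, which must not depend
  -- on `δ`. The trace bound uses further partitions for the same operator.
  obtain ⟨t, ht0, ht, htop, hest, -, ⟨c, hc0, hc⟩, -⟩ := hpart 1 one_pos
  have hbound : ∀ u, ‖sqrtPotentialMap hp hV hVi u‖ ^ 2 ≤
      1 / 2 * ‖testToL2 (diffOp α β u)‖ ^ 2 + c ^ (-4 : ℝ) * ‖testToL2 u‖ ^ 2 := by
    intro u
    refine norm_sqrtPotentialMap_sq_le α β hp hV hVi ht0 ht htop u fun k => (hest k u).trans ?_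
    have h1 : (t (k + 1) - t k) ^ (-4 : ℝ) ≤ c ^ (-4 : ℝ) :=
      Real.rpow_le_rpow_of_nonpos hc0 (hc k) (by norm_num)
    have h2 : 0 ≤ ∫ x in Ioc (t k) (t (k + 1)), ‖u x‖ ^ 2 := by positivity
    have h3 := mul_le_mul_of_nonneg_right h1 h2
    have h4 : 0 ≤ c ^ (-4 : ℝ) * ∫ x in Ioc (t k) (t (k + 1)), ‖u x‖ ^ 2 := by positivity
    linarith
  have M := formModel_graphSpace (j := testToL2) (L := testToL2 ∘ₗ diffOp α β)
    (r := sqrtPotentialMap hp hV hVi) (q := halfLineForm α β V)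
    (by positivity : 0 ≤ c ^ (-4 : ℝ)) denseRange_testToL2 (halfLineForm_eq α β hp hV hVi) hbound
    (fun s h h1 h2 => eq_zero_of_tendsto_diffOp α β h1 h2)
  let P := graphProj testToL2 (testToL2 ∘ₗ diffOp α β) (sqrtPotentialMap hp hV hVi)
  have htrace : ∀ δ : ℝ, 0 < δ →
      DiscreteNegativeSpectrum (invSubConst (formResolvent (P 0) (P 1) (P 2) (c ^ (-4 : ℝ) + 1))
        (c ^ (-4 : ℝ) + 1)) ∧
      traceNegPow (invSubConst (formResolvent (P 0) (P 1) (P 2) (c ^ (-4 : ℝ) + 1))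
        (c ^ (-4 : ℝ) + 1)) γ ≤
        2 * ENNReal.ofReal (((∫ x in Ioi (0 : ℝ), V x ^ p * x ^ ν) + δ) / κ) := by
    intro δ hδ
    obtain ⟨t, ht0, ht, htop, hest, hest0, -, hsum⟩ := hpart δ hδ
    have ha : ∀ k, 0 ≤ (t (k + 1) - t k) ^ (-4 : ℝ) := fun k =>
      Real.rpow_nonneg (sub_pos.2 (ht k)).le _
    have h := M.traceNegPow_le ha (fun E hE => finite_setOf_lt_of_sum_rpow_le ha hγ0 hsum hE)
      (fun k => cauchyData α β (t (k + 1))) (fun E hE u hu => by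
        rw [halfLineForm_eq α β hp hV hVi]
        have h1 := norm_sqrtPotentialMap_sq_le α β hp hV hVi ht0 ht htop u (c := 1) (E := E)
          fun k => by
            have h2 : 0 ≤ ∫ x in Ioc (t k) (t (k + 1)), ‖u x‖ ^ 2 := by positivity
            have h3 : 0 ≤ ∫ x in Ioc (t k) (t (k + 1)), ‖diffOp α β u x‖ ^ 2 := by positivity
            have h4 := mul_nonneg hE.le h2
            -- On short intervals the Cauchy data vanish and no lower order term is present; on the
            -- others that term is at most `E ∫ |u|²`.
            rcases lt_or_ge E ((t (k + 1) - t k) ^ (-4 : ℝ)) with hk | hk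
            · have h5 := hest0 k u (congrFun (hu k hk) 0) (congrFun (hu k hk) 1)
              linarith
            · have h5 := hest k u
              have h6 := mul_le_mul_of_nonneg_right hk h2
              linarith
        linarith) hγ0
    refine ⟨h.1, h.2.trans (mul_le_mul_right ?_ 2)⟩
    refine ENNReal.tsum_le_of_sum_range_le fun n => ?_
    rw [← ENNReal.ofReal_sum_of_nonneg fun k _ => Real.rpow_nonneg (ha k) _]
    exact ENNReal.ofReal_le_ofReal (hsum n)
  refine ⟨M.semibounded, M.closable, _, M.closedForm, _, M.isFormClosure, M.isFormOperator,
    isSelfAdjoint_invSubConst M.isSelfAdjoint_formResolvent M.injective_formResolvent,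
    (htrace 1 one_pos).1, ?_⟩
  -- The left side of the trace bound is independent of `δ`, so `δ` may tend to `0`. This also
  -- covers a potential of zero mass.
  have hlim : Tendsto (fun δ : ℝ => 2 * ENNReal.ofReal
      (((∫ x in Ioi (0 : ℝ), V x ^ p * x ^ ν) + δ) / κ)) (𝓝[>] 0)
      (𝓝 (2 * ENNReal.ofReal (((∫ x in Ioi (0 : ℝ), V x ^ p * x ^ ν) + 0) / κ))) := by
    refine ENNReal.Tendsto.const_mul (ENNReal.tendsto_ofReal ?_) (Or.inr (by simp))
    exact ((continuous_const.add continuous_id).div_const κ).continuousWithinAt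
  refine (ge_of_tendsto hlim (eventually_mem_nhdsWithin.mono fun δ hδ => (htrace δ hδ).2)).trans
    (le_of_eq ?_)
  rw [add_zero, show (2 : ℝ≥0∞) = ENNReal.ofReal 2 by simp,
    ← ENNReal.ofReal_mul (by norm_num : (0 : ℝ) ≤ 2)]
  congr 1
  ring
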